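/- **Theorem 4.3.** Let $(\mathcal U,\Delta)$, $\Delta=\{\delta_1,\dots,\delta_m\}$, be a universal domain for differential algebraic geometry in characteristic zero, i.e. a saturated differentially closed field of characteristic $0$ with $m$ commuting derivations, and let $K$ be a small differential subfield of $\mathcal U$ (that is, $|K|<|\mathcal U|$). Let $n\ge 1$ and $\mathbb P^n=\mathbb P^n(\mathcal U)$. A subset of $\mathbb P^n$ is $\Delta$-closed (resp. $\Delta$-closed and defined over $K$) if it is the zero set of a collection of $\Delta$-homogeneous $\Delta$-polynomials in $y_0,\dots,y_n$ with coefficients in $\mathcal U$ (resp. in $K$); here $f$ is $\Delta$-homogeneous of degree $d$ if $f(ty_0,\dots,ty_n)=t^d f(y_0,\dots,y_n)$ for a further $\Delta$-indeterminate $t$. Closed subsets of $\mathbb P^n\times\mathbb P^r$ are the zero sets of collections of $\Delta$-polynomials that are $\Delta$-homogeneous in each of the two groups of variables. A nonempty set $Z\subseteq\mathbb P^n$ is irreducible over $K$ if, whenever it is contained in the union of two $\Delta$-closed sets defined over $K$, it is contained in one of them. A $\Delta$-closed set $V\subseteq\mathbb P^n$ is complete if for every quasiprojective differential variety $Y$ (a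 relatively open subset of a $\Delta$-closed subset of some $\mathbb P^r$) the second projection $V\times Y\to Y$ is a closed map. Let $V\subseteq\mathbb P^n$ be a complete differential variety, defined over $K$ and irreducible over $K$, and let $ld(V)$ be the set of points $[a_0:\cdots:a_n]\in\mathbb P^n$ that are linearly dependent over $V$, i.e. for which there is a point $[v_0:\cdots:v_n]\in V$ with $\sum_{j=0}^n v_ja_j=0$. Then $ld(V)$ is a $\Delta$-closed subset of $\mathbb P^n$ defined over $K$, and it is irreducible over $K$. -/

import Mathlib

open scoped LinearAlgebra.Projectivization Cardinal

/-- A commutative ring with `m` commuting derivations `der 0, …, der (m - 1)`. -/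
class DeltaRing (m : ℕ) (R : Type*) [CommRing R] where
  der : Fin m → Derivation ℤ R R
  der_comm : ∀ (i j : Fin m) (x : R), der i (der j x) = der j (der i x)

namespace DeltaRing

/-- The derivative operator `δ₁ ^ θ₁ ⋯ δₘ ^ θₘ`. -/
def op (m : ℕ) {R : Type*} [CommRing R] [DeltaRing m R] (θ : Fin m → ℕ) : R →ₗ[ℤ] R :=
  (List.ofFn fun i => ((der i : Derivation ℤ R R) : Module.End ℤ R) ^ θ i).prod

end DeltaRing

/-- The ring `R{y_i : i ∈ σ}` of `Δ`-polynomials: ordinary polynomials in the algebraic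
indeterminates `δ^θ y_i`, indexed by the pairs `(i, θ)`. -/
abbrev DeltaPoly (m : ℕ) (σ R : Type*) [CommRing R] : Type _ :=
  MvPolynomial (σ × (Fin m → ℕ)) R

namespace DeltaPoly

variable {m : ℕ} {σ R : Type*} [CommRing R]

/-- The `Δ`-indeterminate `y_i`. -/
noncomputable def var (i : σ) : DeltaPoly m σ R := MvPolynomial.X (i, 0)

section Derivations

variable [DeltaRing m R]

/-- The map `c ↦ c + ε δ_k c` from `R` to the dual numbers over `R{y}`. -/
noncomputable def dualC (σ : Type*) (k : Fin m) : R →+* DualNumber (DeltaPoly m σ R) where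
  toFun c := TrivSqZeroExt.inl (MvPolynomial.C c) +
    TrivSqZeroExt.inr (MvPolynomial.C (DeltaRing.der k c))
  map_one' := by ext <;> simp
  map_zero' := by ext <;> simp
  map_add' x y := by ext <;> simp
  map_mul' x y := by
    apply TrivSqZeroExt.ext
    · simp
    · simp [smul_eq_mul, mul_comm]

/-- The ring homomorphism `f ↦ f + ε δ_k f` from `R{y}` to its dual numbers, determined by
`c ↦ c + ε δ_k c` on `R` and `δ^θ y_i ↦ δ^θ y_i + ε δ_k δ^θ y_i`. -/
noncomputable def dualHom (σ : Type*) (k : Fin m) :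
    DeltaPoly m σ R →+* DualNumber (DeltaPoly m σ R) :=
  MvPolynomial.eval₂Hom (dualC σ k) fun p =>
    TrivSqZeroExt.inl (MvPolynomial.X p) +
      TrivSqZeroExt.inr (MvPolynomial.X (p.1, p.2 + Pi.single k 1))

theorem fst_dualHom (k : Fin m) (f : DeltaPoly m σ R) : (dualHom σ k f).fst = f := by
  have h : (TrivSqZeroExt.fstHom ℤ (DeltaPoly m σ R) (DeltaPoly m σ R)).toRingHom.comp
      (dualHom σ k) = RingHom.id _ := by
    apply MvPolynomial.ringHom_ext
    · intro r; simp [dualHom, dualC]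
    · intro p; simp [dualHom]
  exact congrArg (fun g : DeltaPoly m σ R →+* DeltaPoly m σ R => g f) h

/-- The derivation `δ_k` of `R{y}`: it extends `δ_k` on `R` and sends `δ^θ y_i` to
`δ_k δ^θ y_i`. -/
noncomputable def derivation (σ : Type*) (k : Fin m) :
    Derivation ℤ (DeltaPoly m σ R) (DeltaPoly m σ R) :=
  Derivation.mk'
    (AddMonoidHom.toIntLinearMap
      { toFun := fun f => (dualHom σ k f).snd
        map_zero' := by simp
        map_add' := fun x y => by simp })
    (fun a b => by
      simp [fst_dualHom, smul_eq_mul, mul_comm])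

theorem derivation_C (k : Fin m) (c : R) :
    derivation σ k (MvPolynomial.C c) = MvPolynomial.C (DeltaRing.der k c) := by
  simp [derivation, dualHom, dualC]

theorem derivation_X (k : Fin m) (p : σ × (Fin m → ℕ)) :
    derivation (R := R) σ k (MvPolynomial.X p) =
      MvPolynomial.X (p.1, p.2 + Pi.single k 1) := by
  simp [derivation, dualHom]

noncomputable instance : DeltaRing m (DeltaPoly m σ R) where
  der := derivation σ
  der_comm i j f := by
    change derivation σ i (derivation σ j f) = derivation σ j (derivation σ i f)
    induction f using MvPolynomial.induction_on with
    | C c => simp [derivation_C, DeltaRing.der_comm i j]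
    | add f g hf hg => simp [hf, hg]
    | mul_X f p hf =>
      simp only [Derivation.leibniz, map_add, smul_eq_mul, derivation_X, hf, add_right_comm]
      ring

end Derivations

/-- The value of a `Δ`-polynomial with coefficients in `R` at a point with coordinates in a
`Δ`-ring `S`, the coefficients being carried to `S` by `φ`. -/
noncomputable def evalVia {S : Type*} [CommRing S] [DeltaRing m S] (φ : R →+* S) (a : σ → S) :
    DeltaPoly m σ R →+* S :=
  MvPolynomial.eval₂Hom φ fun p => DeltaRing.op m p.2 (a p.1)

/-- The value of a `Δ`-polynomial at a point. -/
noncomputable def eval [DeltaRing m R] (a : σ → R) : DeltaPoly m σ R →+* R :=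
  evalVia (RingHom.id R) a

open Classical in
/-- `f` is `Δ`-homogeneous of degree `d` in the indeterminates `y_i`, `i ∈ s`: in `R{t, y}`,
where `t` (the index `none`) is one more `Δ`-indeterminate, replacing `y_i` by `t y_i` for all
`i ∈ s` multiplies `f` by `t ^ d`. -/
def IsHomogeneousIn [DeltaRing m R] (s : Set σ) (d : ℕ) (f : DeltaPoly m σ R) : Prop :=
  evalVia (S := DeltaPoly m (Option σ) R) MvPolynomial.C
      (fun i => if i ∈ s then var none * var (some i) else var (some i)) f =
    var none ^ d *
      evalVia (S := DeltaPoly m (Option σ) R) MvPolynomial.C (fun i => var (some i)) f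

/-- All coefficients of `f` lie in `K`. -/
def HasCoeffsIn {U : Type*} [Field U] (K : Subfield U) (f : DeltaPoly m σ U) : Prop :=
  ∀ e, f.coeff e ∈ K

end DeltaPoly

section Universal

universe u

/-- `K` is closed under the derivations. -/
def IsDeltaSubfield (m : ℕ) {U : Type*} [Field U] [DeltaRing m U] (K : Subfield U) : Prop :=
  ∀ (i : Fin m), ∀ x ∈ K, (DeltaRing.der i : Derivation ℤ U U) x ∈ K

/-- `U` is differentially closed: a finite system of `Δ`-polynomial equations and inequations
over `U` that has a solution in some `Δ`-field extension of `U` has a solution in `U`. -/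
def IsDifferentiallyClosed (m : ℕ) (U : Type u) [Field U] [DeltaRing m U] : Prop :=
  ∀ (k : ℕ) (E N : Finset (DeltaPoly m (Fin k) U)),
    (∃ (L : Type u) (_ : Field L) (_ : DeltaRing m L) (φ : U →+* L),
      (∀ (i : Fin m) (x : U), (DeltaRing.der i : Derivation ℤ L L) (φ x) =
        φ ((DeltaRing.der i : Derivation ℤ U U) x)) ∧
      ∃ a : Fin k → L, (∀ f ∈ E, DeltaPoly.evalVia φ a f = 0) ∧
        ∀ g ∈ N, DeltaPoly.evalVia φ a g ≠ 0) →
    ∃ a : Fin k → U, (∀ f ∈ E, DeltaPoly.eval a f = 0) ∧ ∀ g ∈ N, DeltaPoly.eval a g ≠ 0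

/-- `U` is saturated: a system of `Δ`-polynomial equations and inequations in finitely many
indeterminates over a small differential subfield `F` (one of smaller cardinality than `U`)
has a solution in `U` as soon as each of its finite subsystems does. (The theory of
differentially closed fields eliminates quantifiers, so these are all the types over `F`.) -/
def IsDeltaSaturated (m : ℕ) (U : Type*) [Field U] [DeltaRing m U] : Prop :=
  ∀ F : Subfield U, IsDeltaSubfield m F → #F < #U →
    ∀ (k : ℕ) (E N : Set (DeltaPoly m (Fin k) U)),
      (∀ f ∈ E, f.HasCoeffsIn F) → (∀ g ∈ N, g.HasCoeffsIn F) →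
      (∀ E₀ N₀ : Finset (DeltaPoly m (Fin k) U), (E₀ : Set _) ⊆ E → (N₀ : Set _) ⊆ N →
        ∃ a : Fin k → U,
          (∀ f ∈ E₀, DeltaPoly.eval a f = 0) ∧ ∀ g ∈ N₀, DeltaPoly.eval a g ≠ 0) →
      ∃ a : Fin k → U, (∀ f ∈ E, DeltaPoly.eval a f = 0) ∧ ∀ g ∈ N, DeltaPoly.eval a g ≠ 0

/-- A universal domain for differential algebraic geometry in characteristic zero with `m`
commuting derivations: a saturated differentially closed field. -/
structure IsUniversalDomain (m : ℕ) (U : Type*) [Field U] [DeltaRing m U] : Prop where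
  charZero : CharZero U
  differentiallyClosed : IsDifferentiallyClosed m U
  saturated : IsDeltaSaturated m U

end Universal

section Projective

variable (m : ℕ) {U : Type*} [Field U] [DeltaRing m U] {n r : ℕ}

/-- The `Δ`-closed subsets of `ℙⁿ` defined over `K`: the zero sets of collections of
`Δ`-homogeneous `Δ`-polynomials with coefficients in `K`. -/
def IsDeltaClosedOver (K : Subfield U) (Z : Set (ℙ U (Fin (n + 1) → U))) : Prop :=
  ∃ S : Set (DeltaPoly m (Fin (n + 1)) U),
    (∀ f ∈ S, f.HasCoeffsIn K ∧ ∃ d, f.IsHomogeneousIn Set.univ d) ∧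
    Z = {p | ∀ f ∈ S, DeltaPoly.eval p.rep f = 0}

/-- The `Δ`-closed subsets of `ℙⁿ`. -/
def IsDeltaClosed (Z : Set (ℙ U (Fin (n + 1) → U))) : Prop :=
  IsDeltaClosedOver m ⊤ Z

/-- The `Δ`-closed subsets of `ℙⁿ × ℙʳ`: the zero sets of collections of `Δ`-polynomials that
are `Δ`-homogeneous in each of the two groups of indeterminates. -/
def IsDeltaClosedProd (Z : Set ((ℙ U (Fin (n + 1) → U)) × (ℙ U (Fin (r + 1) → U)))) : Prop :=
  ∃ S : Set (DeltaPoly m (Fin (n + 1) ⊕ Fin (r + 1)) U),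
    (∀ f ∈ S, (∃ d, f.IsHomogeneousIn (Set.range Sum.inl) d) ∧
      ∃ e, f.IsHomogeneousIn (Set.range Sum.inr) e) ∧
    Z = {p | ∀ f ∈ S, DeltaPoly.eval (Sum.elim p.1.rep p.2.rep) f = 0}

/-- A quasiprojective differential variety in `ℙʳ`: a relatively open subset `X \ X'` of a
`Δ`-closed set `X`. -/
def IsQuasiprojective (Y : Set (ℙ U (Fin (r + 1) → U))) : Prop :=
  ∃ X X' : Set (ℙ U (Fin (r + 1) → U)), IsDeltaClosed m X ∧ IsDeltaClosed m X' ∧ Y = X \ X'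

/-- A `Δ`-closed `V ⊆ ℙⁿ` is complete if for every quasiprojective differential variety `Y` the
second projection `V × Y → Y` is a closed map, where `V × Y` and `Y` carry the topologies induced
by the Kolchin topologies of `ℙⁿ × ℙʳ` and `ℙʳ`. -/
def IsDeltaComplete (V : Set (ℙ U (Fin (n + 1) → U))) : Prop :=
  IsDeltaClosed m V ∧
  ∀ (r : ℕ) (Y : Set (ℙ U (Fin (r + 1) → U))), IsQuasiprojective m Y →
    ∀ Z : Set ((ℙ U (Fin (n + 1) → U)) × (ℙ U (Fin (r + 1) → U))), IsDeltaClosedProd m Z →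
      ∃ D : Set (ℙ U (Fin (r + 1) → U)), IsDeltaClosed m D ∧
        Prod.snd '' (Z ∩ V ×ˢ Y) = D ∩ Y

/-- `V` is irreducible over `K`: nonempty, and not covered by two `Δ`-closed sets defined over
`K` unless one of them contains it. -/
def IsIrreducibleOver (K : Subfield U) (V : Set (ℙ U (Fin (n + 1) → U))) : Prop :=
  V.Nonempty ∧ ∀ Z₁ Z₂ : Set (ℙ U (Fin (n + 1) → U)),
    IsDeltaClosedOver m K Z₁ → IsDeltaClosedOver m K Z₂ → V ⊆ Z₁ ∪ Z₂ → V ⊆ Z₁ ∨ V ⊆ Z₂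

end Projective

section LinearDependence

variable {U : Type*} [Field U] {n : ℕ}

/-- The vector `a` is linearly dependent over `V ⊆ ℙⁿ`: some `[v₀ : ⋯ : vₙ] ∈ V` satisfies
`∑ vⱼ aⱼ = 0`. -/
def IsLinDepOver (V : Set (ℙ U (Fin (n + 1) → U))) (a : Fin (n + 1) → U) : Prop :=
  ∃ v ∈ V, ∑ j, v.rep j * a j = 0

/-- The set of points of `ℙⁿ` that are linearly dependent over `V`. -/
def ld (V : Set (ℙ U (Fin (n + 1) → U))) : Set (ℙ U (Fin (n + 1) → U)) :=
  {x | ∃ (a : Fin (n + 1) → U) (ha : a ≠ 0), Projectivization.mk U a ha = x ∧ IsLinDepOver V a}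

end LinearDependence

-- Closedness comes directly from completeness: `ld V` is the second projection of the incidence
-- relation `∑ vⱼ aⱼ = 0` restricted to `V × ℙⁿ`, and that relation is bihomogeneous.
--
-- Descent to `K` is a Galois-type argument in which automorphisms of the universal domain are
-- replaced by conjugate tuples, i.e. tuples satisfying the same `Δ`-equations over `K`. Saturation
-- supplies two facts. Conjugate tuples can be extended by further entries
-- (`IsUniversalDomain.exists_deltaConj_elim`), and an entry outside `K` is moved by some
-- conjugation (`IsUniversalDomain.exists_deltaConj_ne`). The second rests on characteristic zero:
-- for `α` in `F` but not in `K`, the element `1 ⊗ α - α ⊗ 1` of `F ⊗ F` over `K` is not nilpotent.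
-- Together with an elimination argument on supports they show that a conjugation-invariant closed
-- set is defined over `K` (`IsDeltaClosed.isDeltaClosedOver`). The set `ld V` is invariant, because
-- a witness in `V` can be moved along with the point.
--
-- For irreducibility, suppose two closed sets over `K` cover `ld V` and neither contains it. Choose
-- defining polynomials `f₁`, `f₂` of the two sets, each nonzero somewhere on `ld V`. For each `v`
-- in `V` the hyperplane orthogonal to `v` is a linear image of an affine space, so it is
-- irreducible and lies in the zero set of `f₁` or of `f₂`. Hence `V` is the union of the loci of
-- points whose hyperplane lies in one given zero set. Each locus is closed, since the hyperplane is
-- parametrized by alternating matrices applied to `v`, and it is conjugation-invariant, hence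
-- defined over `K`. Irreducibility of `V` puts all of `V` in one locus, contradicting the choice of
-- that polynomial.

universe u

/-! ### Derivative operators and differential homomorphisms. -/

namespace DeltaRing

variable {m : ℕ} {R S T : Type*} [CommRing R] [CommRing S] [CommRing T]

theorem commute_der [DeltaRing m R] (i j : Fin m) :
    Commute ((der i : Derivation ℤ R R) : Module.End ℤ R)
      ((der j : Derivation ℤ R R) : Module.End ℤ R) :=
  LinearMap.ext fun x => der_comm i j x

theorem op_zero [DeltaRing m R] (x : R) : op m (0 : Fin m → ℕ) x = x := by
  simp [op]

/-- The product is ordered, so commutativity is needed to bring the extra factor to the front past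
the earlier ones. -/
theorem prod_ofFn_pow_add_single {M : Type*} [Monoid M] {m : ℕ} (f : Fin m → M)
    (hf : ∀ i j, Commute (f i) (f j)) (θ : Fin m → ℕ) (k : Fin m) :
    (List.ofFn fun i => f i ^ (θ + Pi.single k 1 : Fin m → ℕ) i).prod =
      f k * (List.ofFn fun i => f i ^ θ i).prod := by
  induction m with
  | zero => exact k.elim0
  | succ m ih =>
    rw [List.ofFn_succ, List.ofFn_succ, List.prod_cons, List.prod_cons]
    refine Fin.cases ?_ (fun k => ?_) k
    · simp [pow_succ', mul_assoc]
    · have h := ih (fun i => f i.succ) (fun i j => hf _ _) (fun i => θ i.succ) k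
      have e : (fun i : Fin m => f i.succ ^ (θ + Pi.single k.succ 1 : Fin (m + 1) → ℕ) i.succ) =
          fun i => f i.succ ^ ((fun i => θ i.succ) + Pi.single k 1 : Fin m → ℕ) i := by
        funext i
        simp [Pi.single_apply]
      rw [e, h, ← mul_assoc, ← mul_assoc]
      congr 1
      simp only [Pi.add_apply, ne_eq, (Fin.succ_ne_zero k).symm, not_false_eq_true,
        Pi.single_eq_of_ne, add_zero]
      exact ((hf k.succ 0).pow_right _).eq.symm

theorem op_add_single [DeltaRing m R] (θ : Fin m → ℕ) (k : Fin m) (x : R) :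
    op m (θ + Pi.single k 1) x = der k (op m θ x) := by
  unfold op
  rw [prod_ofFn_pow_add_single (fun i => ((der i : Derivation ℤ R R) : Module.End ℤ R))
    commute_der]
  rfl

/-- Induction on multi-indices by raising one entry at a time. -/
theorem multiindex_induction {m : ℕ} {p : (Fin m → ℕ) → Prop} (h0 : p 0)
    (hs : ∀ θ k, p θ → p (θ + Pi.single k 1)) (θ : Fin m → ℕ) : p θ := by
  induction h : ∑ i, θ i generalizing θ with
  | zero =>
    have : θ = 0 := by
      funext i
      simpa using (Finset.sum_eq_zero_iff.1 h) i (Finset.mem_univ i)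
    rwa [this]
  | succ s ih =>
    obtain ⟨k, hk⟩ : ∃ k, θ k ≠ 0 := by
      by_contra! hk
      simp [hk] at h
    have e : θ = (θ - Pi.single k 1) + Pi.single k 1 := by
      funext i
      by_cases hik : i = k
      · subst hik; simp; omega
      · simp [hik]
    rw [e]
    refine hs _ _ (ih _ ?_)
    have : ∑ i, θ i = ∑ i, (θ - Pi.single k 1 : Fin m → ℕ) i + 1 := by
      conv_lhs => rw [e]
      simp [Finset.sum_add_distrib]
    omega

/-- Ring homomorphisms that commute with the derivations. -/
def IsDeltaHom (m : ℕ) [DeltaRing m R] [DeltaRing m S] (φ : R →+* S) : Prop :=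
  ∀ (i : Fin m) (x : R), (der i : Derivation ℤ S S) (φ x) = φ ((der i : Derivation ℤ R R) x)

theorem IsDeltaHom.comp [DeltaRing m R] [DeltaRing m S] [DeltaRing m T] {ψ : S →+* T} {φ : R →+* S}
    (hψ : IsDeltaHom m ψ) (hφ : IsDeltaHom m φ) : IsDeltaHom m (ψ.comp φ) := fun i x => by
  simp [hψ i, hφ i]

theorem IsDeltaHom.op [DeltaRing m R] [DeltaRing m S] {φ : R →+* S} (hφ : IsDeltaHom m φ)
    (θ : Fin m → ℕ) (x : R) : DeltaRing.op m θ (φ x) = φ (DeltaRing.op m θ x) := by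
  induction θ using multiindex_induction with
  | h0 => simp [op_zero]
  | hs θ k ih => rw [op_add_single, op_add_single, ih, hφ]

theorem isDeltaHom_id [DeltaRing m R] : IsDeltaHom m (RingHom.id R) := fun _ _ => rfl

end DeltaRing

/-! ### Evaluation and substitution of differential polynomials. -/

namespace DeltaPoly

open DeltaRing

variable {m : ℕ} {σ τ R S T : Type*} [CommRing R] [CommRing S] [CommRing T]

theorem der_C [DeltaRing m R] (k : Fin m) (c : R) :
    (der k : Derivation ℤ (DeltaPoly m σ R) _) (MvPolynomial.C c) =
      MvPolynomial.C ((der k : Derivation ℤ R R) c) :=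
  derivation_C k c

theorem der_X [DeltaRing m R] (k : Fin m) (p : σ × (Fin m → ℕ)) :
    (der k : Derivation ℤ (DeltaPoly m σ R) _) (MvPolynomial.X p) =
      MvPolynomial.X (p.1, p.2 + Pi.single k 1) :=
  derivation_X k p

theorem isDeltaHom_C [DeltaRing m R] :
    IsDeltaHom m (MvPolynomial.C : R →+* DeltaPoly m σ R) := fun i x => der_C i x

theorem op_var [DeltaRing m R] (i : σ) (θ : Fin m → ℕ) :
    op m θ (var i : DeltaPoly m σ R) = MvPolynomial.X (i, θ) := by
  induction θ using multiindex_induction with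
  | h0 => rw [op_zero]; rfl
  | hs θ k ih => rw [op_add_single, ih, der_X]

section EvalVia

variable [DeltaRing m S]

@[simp] theorem evalVia_C (φ : R →+* S) (a : σ → S) (c : R) :
    evalVia (m := m) φ a (MvPolynomial.C c) = φ c := by simp [evalVia]

@[simp] theorem evalVia_X (φ : R →+* S) (a : σ → S) (p : σ × (Fin m → ℕ)) :
    evalVia φ a (MvPolynomial.X p) = op m p.2 (a p.1) := by simp [evalVia]

@[simp] theorem evalVia_var (φ : R →+* S) (a : σ → S) (i : σ) :
    evalVia (m := m) φ a (var i) = a i := by simp [var, op_zero]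

/-- Both sides obey the Leibniz rule, and on indeterminates the claim is `op_add_single`. This is
what makes kernels of evaluations `Δ`-ideals and lets evaluation pass through substitutions. -/
theorem evalVia_isDeltaHom [DeltaRing m R] {φ : R →+* S} (hφ : IsDeltaHom m φ) (a : σ → S) :
    IsDeltaHom m (evalVia (m := m) φ a) := by
  intro k f
  induction f using MvPolynomial.induction_on with
  | C c => rw [der_C, evalVia_C, evalVia_C, hφ]
  | add f g hf hg => simp only [map_add, hf, hg]
  | mul_X f p hf =>
    rw [map_mul, Derivation.leibniz, Derivation.leibniz, map_add, hf, der_X]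
    simp [op_add_single]

theorem map_evalVia [DeltaRing m T] {ψ : S →+* T} (hψ : IsDeltaHom m ψ) (φ : R →+* S) (a : σ → S)
    (f : DeltaPoly m σ R) : ψ (evalVia φ a f) = evalVia (ψ.comp φ) (fun i => ψ (a i)) f := by
  change (ψ.comp (evalVia φ a)) f = _
  congr 1
  apply MvPolynomial.ringHom_ext
  · simp
  · simp [hψ.op]

theorem evalVia_map (ψ : R →+* T) (φ : T →+* S) (a : σ → S) (f : DeltaPoly m σ R) :
    evalVia φ a (MvPolynomial.map ψ f) = evalVia (φ.comp ψ) a f := by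
  simp [evalVia]

theorem evalVia_C_var [DeltaRing m R] (f : DeltaPoly m σ R) :
    evalVia (m := m) MvPolynomial.C var f = f := by
  have : evalVia (m := m) MvPolynomial.C var = RingHom.id (DeltaPoly m σ R) := by
    apply MvPolynomial.ringHom_ext <;> simp [op_var]
  simp [this]

theorem evalVia_subst [DeltaRing m R] {φ : R →+* S} (hφ : IsDeltaHom m φ) (a : τ → S)
    (b : σ → DeltaPoly m τ R) (f : DeltaPoly m σ R) :
    evalVia φ a (evalVia MvPolynomial.C b f) = evalVia φ (fun i => evalVia φ a (b i)) f := by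
  rw [map_evalVia (evalVia_isDeltaHom hφ a)]
  congr 1
  congr 1
  ext; simp

theorem isDeltaHom_map [DeltaRing m R] [DeltaRing m T] {φ : R →+* T} (hφ : IsDeltaHom m φ) :
    IsDeltaHom m (MvPolynomial.map (σ := σ × (Fin m → ℕ)) φ) := by
  have h : MvPolynomial.map φ = evalVia (m := m) (σ := σ) (MvPolynomial.C.comp φ) var := by
    apply MvPolynomial.ringHom_ext <;> simp [op_var]
  rw [h]
  exact evalVia_isDeltaHom (isDeltaHom_C.comp hφ) var

end EvalVia

section Eval

variable [DeltaRing m R]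

@[simp] theorem eval_var (a : σ → R) (i : σ) : eval (m := m) a (var i) = a i := evalVia_var _ _ _

@[simp] theorem eval_C (a : σ → R) (c : R) : eval (m := m) a (MvPolynomial.C c) = c :=
  evalVia_C _ _ _

theorem eval_subst (a : τ → R) (b : σ → DeltaPoly m τ R) (f : DeltaPoly m σ R) :
    eval a (evalVia MvPolynomial.C b f) = eval (fun i => eval a (b i)) f :=
  evalVia_subst isDeltaHom_id a b f

theorem eval_map {T : Type*} [CommRing T] (φ : T →+* R) (a : σ → R) (f : DeltaPoly m σ T) :
    eval a (MvPolynomial.map φ f) = evalVia φ a f := by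
  simp [eval, evalVia_map]

theorem IsHomogeneousIn.eval_smul {s : Set σ} [DecidablePred (· ∈ s)] {d : ℕ}
    {f : DeltaPoly m σ R} (hf : f.IsHomogeneousIn s d) (t : R) (a : σ → R) :
    eval (fun i => if i ∈ s then t * a i else a i) f = t ^ d * eval a f := by
  classical
  -- The defining identity of homogeneity lives in `R{t, y}`; it is specialized at the given scalar
  -- and point.
  have h := congrArg (eval (m := m) (fun o : Option σ => o.elim t a)) hf
  rw [map_mul, map_pow, eval_subst, eval_subst] at h
  simp only [eval_var, Option.elim_none, Option.elim_some] at h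
  rw [← h]
  congr 2
  funext i
  split_ifs <;> simp

theorem IsHomogeneousIn.eval_smul_univ {d : ℕ} {f : DeltaPoly m σ R}
    (hf : f.IsHomogeneousIn Set.univ d) (t : R) (a : σ → R) :
    eval (t • a) f = t ^ d * eval a f := by
  classical
  rw [← hf.eval_smul t a]
  congr 2

end Eval

end DeltaPoly

/-! ### Differential ideals and prime extensions. -/

namespace DeltaRing

variable {m : ℕ} {R S : Type*} [CommRing R] [CommRing S] [DeltaRing m R] [DeltaRing m S]

/-- Ideals that are closed under the derivations. -/
def IsDeltaIdeal (m : ℕ) [DeltaRing m R] (I : Ideal R) : Prop :=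
  ∀ (k : Fin m), ∀ x ∈ I, (der k : Derivation ℤ R R) x ∈ I

theorem isDeltaIdeal_bot : IsDeltaIdeal m (⊥ : Ideal R) := by
  intro k x hx
  rw [Ideal.mem_bot] at hx ⊢
  rw [hx, map_zero]

theorem IsDeltaHom.isDeltaIdeal_ker {φ : R →+* S} (hφ : IsDeltaHom m φ) :
    IsDeltaIdeal m (RingHom.ker φ) := by
  intro k x hx
  rw [RingHom.mem_ker] at hx ⊢
  rw [← hφ, hx, map_zero]

theorem IsDeltaIdeal.map {φ : R →+* S} (hφ : IsDeltaHom m φ) {I : Ideal R}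
    (hI : IsDeltaIdeal m I) : IsDeltaIdeal m (I.map φ) := by
  intro k x hx
  refine Submodule.span_induction (p := fun x _ => (der k : Derivation ℤ S S) x ∈ I.map φ)
    ?_ ?_ ?_ ?_ hx
  · rintro _ ⟨y, hy, rfl⟩
    rw [hφ]
    exact Ideal.mem_map_of_mem _ (hI k y hy)
  · simp
  · intro x y _ _ hx hy
    rw [map_add]
    exact add_mem hx hy
  · intro a x hx' hx
    rw [smul_eq_mul, Derivation.leibniz]
    exact add_mem (Ideal.mul_mem_left _ _ hx) (Ideal.mul_mem_right _ _ hx')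

/-- Each step trades one factor `x` for two factors `y = δx`: differentiate `x ^ (i + 1) * y ^ (2 *
j)`, multiply by `y`, remove the term containing `δy`, and divide by `i + 1`. At `i = 0` a power of
`δx` lies in the ideal. -/
theorem IsDeltaIdeal.pow_mul_der_mem [Algebra ℚ R] {I : Ideal R} (hI : IsDeltaIdeal m I) (k : Fin m)
    {x : R} {N : ℕ} (hx : x ^ N ∈ I) (j : ℕ) :
    ∀ i, i + j = N → x ^ i * ((der k : Derivation ℤ R R) x) ^ (2 * j) ∈ I := by
  induction j with
  | zero => rintro i rfl; simpa using hx
  | succ j ih =>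
    rintro i h
    have h1 := ih (i + 1) (by omega)
    have h2 := hI k _ h1
    set y := (der k : Derivation ℤ R R) x with hy
    rw [Derivation.leibniz, Derivation.leibniz_pow, Derivation.leibniz_pow] at h2
    have h3 : ((i + 1 : ℕ) : R) * (x ^ i * y ^ (2 * (j + 1))) ∈ I := by
      have h4 := I.sub_mem (I.mul_mem_left y h2)
        (I.mul_mem_left ((2 * j : ℕ) * (der k : Derivation ℤ R R) y) h1)
      -- The case `j = 0` is separate because the exponent `2 * j - 1` is truncated there.
      rcases j with _ | j
      · convert h4 using 1
        simp [← hy]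
        ring
      · convert h4 using 1
        simp only [smul_eq_mul, nsmul_eq_mul, ← hy, Nat.add_sub_cancel,
          show 2 * (j + 1) - 1 = 2 * j + 1 by omega]
        push_cast
        ring
    have h5 := I.mul_mem_left (algebraMap ℚ R ((i + 1 : ℕ) : ℚ)⁻¹) h3
    rwa [← mul_assoc, ← map_natCast (algebraMap ℚ R), ← map_mul, inv_mul_cancel₀, map_one,
      one_mul] at h5
    positivity

theorem IsDeltaIdeal.radical [Algebra ℚ R] {I : Ideal R} (hI : IsDeltaIdeal m I) :
    IsDeltaIdeal m I.radical := by
  rintro k x ⟨N, hN⟩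
  exact ⟨2 * N, by simpa using hI.pow_mul_der_mem k hN N 0 (by simp)⟩

/-- If `b * a ∈ I`, then `(δb * a) ^ 2` is a combination of `δ(b * a)` and `b * a`, and radicality
removes the square. -/
theorem IsDeltaIdeal.colon_singleton {I : Ideal R} (hI : IsDeltaIdeal m I) (hr : I.IsRadical)
    (a : R) : IsDeltaIdeal m (I.colon {a}) := by
  intro k b hb
  rw [Submodule.mem_colon_singleton, smul_eq_mul] at hb ⊢
  have h := hI k _ hb
  rw [Derivation.leibniz, smul_eq_mul, smul_eq_mul] at h
  refine hr ⟨2, ?_⟩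
  have h' := I.sub_mem (I.mul_mem_left ((der k : Derivation ℤ R R) b * a) h)
    (I.mul_mem_left ((der k : Derivation ℤ R R) b * (der k : Derivation ℤ R R) a) hb)
  convert h' using 1
  ring

/-- In a `ℚ`-algebra, a `Δ`-ideal disjoint from a submonoid extends to a prime `Δ`-ideal disjoint
from it. -/
theorem IsDeltaIdeal.exists_le_prime_disjoint [Algebra ℚ R] {I : Ideal R} (hI : IsDeltaIdeal m I)
    (M : Submonoid R) (hM : Disjoint (I : Set R) M) :
    ∃ P : Ideal R, P.IsPrime ∧ IsDeltaIdeal m P ∧ I ≤ P ∧ Disjoint (P : Set R) M := by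
  obtain ⟨P, hIP, hP⟩ := zorn_le_nonempty₀
    {J : Ideal R | IsDeltaIdeal m J ∧ Disjoint (J : Set R) M} (fun c hc hchain J hJ => by
      have hmem : ∀ {x}, x ∈ sSup c ↔ ∃ J ∈ c, x ∈ J := fun {x} =>
        Submodule.mem_sSup_of_directed ⟨J, hJ⟩ hchain.directedOn
      refine ⟨sSup c, ⟨fun k x hx => ?_, ?_⟩, fun J hJ => le_sSup hJ⟩
      · obtain ⟨J, hJ, hx⟩ := hmem.1 hx
        exact hmem.2 ⟨J, hJ, (hc hJ).1 k x hx⟩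
      · rw [Set.disjoint_left]
        intro x hx
        obtain ⟨J, hJ, hx⟩ := hmem.1 hx
        exact Set.disjoint_left.1 (hc hJ).2 hx) I ⟨hI, hM⟩
  obtain ⟨hPd, hPM⟩ := hP.prop
  have hPM' : ∀ x ∈ P, x ∉ M := fun x hx hxM => Set.disjoint_left.1 hPM hx hxM
  -- By maximality, every `Δ`-ideal strictly above `P` meets `M`. This is applied to the radical of
  -- `P`, then to two colon ideals, which yield `s, t ∈ M` with `t * s ∈ P`.
  have hmax : ∀ J : Ideal R, IsDeltaIdeal m J → P ≤ J → (∃ x ∈ J, x ∉ P) → ∃ s ∈ M, s ∈ J := by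
    rintro J hJ hPJ ⟨x, hxJ, hxP⟩
    by_contra! h
    exact hxP (hP.le_of_ge ⟨hJ, Set.disjoint_left.2 fun s hs hsM => h s hsM hs⟩ hPJ hxJ)
  have hrad : P.IsRadical := by
    intro x hx
    by_contra hxP
    obtain ⟨s, hsM, N, hN⟩ := hmax _ hPd.radical Ideal.le_radical ⟨x, hx, hxP⟩
    exact hPM' _ hN (pow_mem hsM N)
  have hle : ∀ a, P ≤ P.colon {a} := fun a x hx => by
    rw [Submodule.mem_colon_singleton, smul_eq_mul]
    exact P.mul_mem_right _ hx
  refine ⟨P, ⟨?_, ?_⟩, hPd, hIP, hPM⟩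
  · rintro rfl
    exact hPM' 1 trivial M.one_mem
  · intro a b hab
    by_contra! h
    obtain ⟨s, hsM, hs⟩ := hmax _ (hPd.colon_singleton hrad a) (hle a)
      ⟨b, by rwa [Submodule.mem_colon_singleton, smul_eq_mul, mul_comm], h.2⟩
    rw [Submodule.mem_colon_singleton, smul_eq_mul] at hs
    obtain ⟨t, htM, ht⟩ := hmax _ (hPd.colon_singleton hrad s) (hle s)
      ⟨a, by rwa [Submodule.mem_colon_singleton, smul_eq_mul, mul_comm], h.1⟩
    rw [Submodule.mem_colon_singleton, smul_eq_mul] at ht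
    exact hPM' _ ht (mul_mem htM hsM)

/-! ### Derivations on the fraction field of a differential quotient. -/

section FractionField

variable {L : Type*} [Field L] {P : Ideal R} [Algebra (R ⧸ P) L]

/-- The map `r ↦ r + ε δ_k r` from `R` to the dual numbers over an `R ⧸ P`-algebra `L`. -/
noncomputable def quotientDual (L : Type*) [Field L] (P : Ideal R) [Algebra (R ⧸ P) L] (k : Fin m) :
    R →+* DualNumber L where
  toFun r := TrivSqZeroExt.inl (algebraMap (R ⧸ P) L (Ideal.Quotient.mk P r)) +
    TrivSqZeroExt.inr (algebraMap (R ⧸ P) L (Ideal.Quotient.mk P ((der k : Derivation ℤ R R) r)))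
  map_one' := by ext <;> simp
  map_zero' := by ext <;> simp
  map_add' x y := by ext <;> simp [Algebra.smul_def]
  map_mul' x y := by
    apply TrivSqZeroExt.ext
    · simp
    · simp only [Derivation.leibniz, smul_eq_mul, map_add, map_mul, TrivSqZeroExt.snd_add,
        TrivSqZeroExt.snd_inl, TrivSqZeroExt.snd_inr, zero_add, TrivSqZeroExt.snd_mul,
        TrivSqZeroExt.fst_add, TrivSqZeroExt.fst_inl, TrivSqZeroExt.fst_inr, add_zero,
        MulOpposite.smul_eq_mul_unop, MulOpposite.unop_op]
      ring

variable [IsFractionRing (R ⧸ P) L]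

/-- The map `x ↦ x + ε δ_k x` on the fraction field `L` of `R ⧸ P`. -/
noncomputable def fractionDual (L : Type*) [Field L] [Algebra (R ⧸ P) L] [IsFractionRing (R ⧸ P) L]
    [P.IsPrime] (hP : IsDeltaIdeal m P) (k : Fin m) : L →+* DualNumber L :=
  IsLocalization.lift (M := nonZeroDivisors (R ⧸ P))
    (g := Ideal.Quotient.lift P (quotientDual L P k) fun x hx => by
      apply TrivSqZeroExt.ext
      · simp [quotientDual, Ideal.Quotient.eq_zero_iff_mem.2 hx]
      · simp [quotientDual, Ideal.Quotient.eq_zero_iff_mem.2 (hP k x hx)])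
    (fun y => by
      obtain ⟨y, hy⟩ := y
      obtain ⟨y, rfl⟩ := Ideal.Quotient.mk_surjective y
      -- A dual number over a field is invertible as soon as its constant part is nonzero.
      rw [TrivSqZeroExt.isUnit_iff_isUnit_fst, isUnit_iff_ne_zero]
      simpa [quotientDual] using nonZeroDivisors.ne_zero hy)

variable [P.IsPrime] (hP : IsDeltaIdeal m P)

theorem fractionDual_algebraMap (k : Fin m) (r : R) :
    fractionDual L hP k (algebraMap (R ⧸ P) L (Ideal.Quotient.mk P r)) = quotientDual L P k r := by
  rw [fractionDual, IsLocalization.lift_eq]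
  simp

theorem fst_fractionDual (k : Fin m) (x : L) : (fractionDual L hP k x).fst = x := by
  have h : (TrivSqZeroExt.fstHom ℤ L L).toRingHom.comp (fractionDual L hP k) = RingHom.id _ := by
    apply IsLocalization.ringHom_ext (nonZeroDivisors (R ⧸ P))
    apply Ideal.Quotient.ringHom_ext
    ext r
    simp [fractionDual_algebraMap, quotientDual]
  exact congrArg (fun g : L →+* L => g x) h

/-- The derivation of the fraction field `L` of `R ⧸ P` induced by `δ_k`. -/
noncomputable def fractionDerivation (L : Type*) [Field L] [Algebra (R ⧸ P) L]
    [IsFractionRing (R ⧸ P) L] (k : Fin m) : Derivation ℤ L L :=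
  Derivation.mk'
    (AddMonoidHom.toIntLinearMap
      { toFun := fun f => (fractionDual L hP k f).snd
        map_zero' := by simp
        map_add' := fun x y => by simp })
    (fun a b => by
      simp [fst_fractionDual, smul_eq_mul, mul_comm])

theorem fractionDerivation_algebraMap (k : Fin m) (r : R) :
    fractionDerivation hP L k (algebraMap (R ⧸ P) L (Ideal.Quotient.mk P r)) =
      algebraMap (R ⧸ P) L (Ideal.Quotient.mk P ((der k : Derivation ℤ R R) r)) := by
  change (fractionDual L hP k _).snd = _
  rw [fractionDual_algebraMap, quotientDual, RingHom.coe_mk, MonoidHom.coe_mk, OneHom.coe_mk,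
    TrivSqZeroExt.snd_add, TrivSqZeroExt.snd_inl, TrivSqZeroExt.snd_inr, zero_add]

omit [DeltaRing m R] [P.IsPrime] in
-- From `x * b = a` one gets `b * D x = 0` with `b ≠ 0`. Applied to commutators, it shows that the
-- induced derivations commute.
theorem derivation_eq_zero_of_isFractionRing (D : Derivation ℤ L L)
    (hD : ∀ r : R ⧸ P, D (algebraMap (R ⧸ P) L r) = 0) (x : L) : D x = 0 := by
  obtain ⟨⟨a, b⟩, h⟩ := IsLocalization.surj (nonZeroDivisors (R ⧸ P)) x
  have hb := (IsLocalization.map_units L b).ne_zero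
  have h' := hD a
  rw [← h, Derivation.leibniz, hD, smul_zero, zero_add, smul_eq_mul] at h'
  exact (mul_eq_zero.1 h').resolve_left hb

/-- The `Δ`-structure on the fraction field `L` of `R ⧸ P`. -/
@[reducible] noncomputable def fractionDeltaRing (L : Type*) [Field L] [Algebra (R ⧸ P) L]
    [IsFractionRing (R ⧸ P) L] : DeltaRing m L where
  der := fractionDerivation hP L
  der_comm i j x := by
    have := derivation_eq_zero_of_isFractionRing (P := P)
      ⁅fractionDerivation hP L i, fractionDerivation hP L j⁆ (fun r => by
        obtain ⟨r, rfl⟩ := Ideal.Quotient.mk_surjective r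
        simp [Derivation.commutator_apply, fractionDerivation_algebraMap, der_comm i j]) x
    rwa [Derivation.commutator_apply, sub_eq_zero] at this

end FractionField

/-- A prime `Δ`-ideal `P` of `R` is the kernel of a `Δ`-homomorphism to the fraction field `L` of
`R ⧸ P`. -/
theorem IsDeltaIdeal.exists_fractionField {R : Type u} [CommRing R] [DeltaRing m R] {P : Ideal R}
    [P.IsPrime] (hP : IsDeltaIdeal m P) :
    ∃ (L : Type u) (_ : Field L) (_ : DeltaRing m L) (ι : R →+* L), IsDeltaHom m ι ∧
      RingHom.ker ι = P ∧ Cardinal.mk L ≤ Cardinal.mk R ∧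
      ∀ (U : Type u) [Field U] [DeltaRing m U] (ψ : R →+* U), IsDeltaHom m ψ → RingHom.ker ψ = P →
        ∃ φ : L →+* U, IsDeltaHom m φ ∧ φ.comp ι = ψ := by
  refine ⟨FractionRing (R ⧸ P), inferInstance, fractionDeltaRing hP _,
    (algebraMap (R ⧸ P) _).comp (Ideal.Quotient.mk P),
    fun k r => fractionDerivation_algebraMap hP k r, ?_, ?_, ?_⟩
  · ext x
    simp [RingHom.mem_ker, Ideal.Quotient.eq_zero_iff_mem]
  · exact (IsLocalization.cardinalMk_le (nonZeroDivisors (R ⧸ P))).trans Cardinal.mk_quotient_le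
  · intro U _ _ ψ hψ hker
    set ψ' : R ⧸ P →+* U := Ideal.Quotient.lift P ψ fun x hx => by
      rwa [← hker, RingHom.mem_ker] at hx with hψ'
    have hinj : Function.Injective ψ' := by
      rw [injective_iff_map_eq_zero]
      intro x hx
      obtain ⟨x, rfl⟩ := Ideal.Quotient.mk_surjective x
      rw [Ideal.Quotient.eq_zero_iff_mem, ← hker, RingHom.mem_ker]
      exact hx
    set φ : FractionRing (R ⧸ P) →+* U := IsFractionRing.lift hinj with hφ
    have hφι : ∀ r : R, φ (algebraMap (R ⧸ P) _ (Ideal.Quotient.mk P r)) = ψ r := fun r => by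
      rw [hφ, IsFractionRing.lift_algebraMap]
      rfl
    refine ⟨φ, fun k x => ?_, RingHom.ext hφι⟩
    change _ = φ (fractionDerivation hP _ k x)
    obtain ⟨⟨a, b⟩, h⟩ := IsLocalization.surj (nonZeroDivisors (R ⧸ P)) x
    obtain ⟨b, hb⟩ := b
    obtain ⟨a, rfl⟩ := Ideal.Quotient.mk_surjective a
    obtain ⟨b, rfl⟩ := Ideal.Quotient.mk_surjective b
    have hb0 : ψ b ≠ 0 := by
      rw [← hφι]
      simpa using nonZeroDivisors.ne_zero hb
    simp only at h
    -- Differentiating `x * b = a` after and before applying `φ` gives two equations that differ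
    -- only in the derivative of `x`, whose factor `ψ b` cancels.
    have h1 := congrArg (fun y => (der k : Derivation ℤ U U) (φ y)) h
    have h2 := congrArg (fun y => φ (fractionDerivation hP _ k y)) h
    simp only [map_mul, Derivation.leibniz, smul_eq_mul, map_add, hφι, hψ k,
      fractionDerivation_algebraMap] at h1 h2
    have h3 := h1.trans h2.symm
    exact mul_left_cancel₀ hb0 (add_left_cancel h3)

end DeltaRing

open DeltaRing DeltaPoly

section Reindex

variable {m : ℕ} {σ τ R : Type*} [CommRing R] [DeltaRing m R]

namespace DeltaPoly

theorem subst_var_equiv (e : σ ≃ τ) (f : DeltaPoly m τ R) :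
    evalVia (S := DeltaPoly m τ R) MvPolynomial.C (fun i => var (e i))
      (evalVia (S := DeltaPoly m σ R) MvPolynomial.C (fun j => var (e.symm j)) f) = f := by
  rw [evalVia_subst isDeltaHom_C]
  simp only [evalVia_var, Equiv.apply_symm_apply]
  exact evalVia_C_var f

end DeltaPoly

end Reindex

/-- The extension of polynomial rings is a base change of a field extension, hence faithfully flat.
-/
theorem MvPolynomial.comap_map_field {σ F U : Type*} [Field F] [Field U] (φ : F →+* U)
    (I : Ideal (MvPolynomial σ F)) : (I.map (map φ)).comap (map φ) = I := by
  let _ : Algebra F U := φ.toAlgebra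
  let _ : Algebra (MvPolynomial σ F) (MvPolynomial σ U) := algebraMvPolynomial
  have : Module.FaithfullyFlat (MvPolynomial σ F) (MvPolynomial σ U) :=
    Module.FaithfullyFlat.of_linearEquiv _ _
      (Algebra.IsPushout.equiv F (MvPolynomial σ F) U (MvPolynomial σ U)).toLinearEquiv.symm
  exact Ideal.comap_map_eq_self_of_faithfullyFlat (B := MvPolynomial σ U) I

/-! ### Realizing differential ideals by points of the universal domain. -/

section Realization

variable {m : ℕ} {U : Type u} [Field U] [DeltaRing m U]

theorem IsDifferentiallyClosed.exists_fin_solution [CharZero U] (hU : IsDifferentiallyClosed m U)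
    {k : ℕ} {I : Ideal (DeltaPoly m (Fin k) U)} (hI : IsDeltaIdeal m I)
    {M : Submonoid (DeltaPoly m (Fin k) U)} (hM : Disjoint (I : Set (DeltaPoly m (Fin k) U)) M)
    (E N : Finset (DeltaPoly m (Fin k) U)) (hE : ∀ f ∈ E, f ∈ I) (hN : ∀ g ∈ N, g ∈ M) :
    ∃ a : Fin k → U, (∀ f ∈ E, eval a f = 0) ∧ ∀ g ∈ N, eval a g ≠ 0 := by
  obtain ⟨P, hP, hPd, hIP, hPM⟩ := hI.exists_le_prime_disjoint M hM
  obtain ⟨L, _, _, ι, hι, hker, -, -⟩ := hPd.exists_fractionField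
  -- The images of the indeterminates form a generic point of `P` in the extension field.
  have key : ∀ f, evalVia (ι.comp MvPolynomial.C) (fun i => ι (var i)) f = ι f := fun f => by
    rw [← map_evalVia hι, evalVia_C_var]
  refine hU k E N ⟨L, inferInstance, inferInstance, ι.comp MvPolynomial.C,
    hι.comp isDeltaHom_C, fun i => ι (var i), fun f hf => ?_, fun g hg => ?_⟩
  · rw [key, ← RingHom.mem_ker, hker]
    exact hIP (hE f hf)
  · rw [key, Ne, ← RingHom.mem_ker, hker]
    exact fun h => Set.disjoint_left.1 hPM h (hN g hg)

/-- A nonzero `Δ`-polynomial over a differentially closed field has a point where it does not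
vanish. -/
theorem IsDifferentiallyClosed.exists_eval_ne_zero [CharZero U] (hU : IsDifferentiallyClosed m U)
    {σ : Type*} [Finite σ] {f : DeltaPoly m σ U} (hf : f ≠ 0) : ∃ a : σ → U, eval a f ≠ 0 := by
  obtain ⟨k, ⟨e⟩⟩ := Finite.exists_equiv_fin σ
  set g : DeltaPoly m (Fin k) U := evalVia MvPolynomial.C (fun i => var (e i)) f with hg
  have hg0 : g ≠ 0 := by
    intro h
    apply hf
    rw [← subst_var_equiv e.symm f]
    simp only [Equiv.symm_symm]
    rw [← hg, h, map_zero]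
  obtain ⟨a, -, ha⟩ := hU.exists_fin_solution (isDeltaIdeal_bot (m := m))
    (M := nonZeroDivisors (DeltaPoly m (Fin k) U)) (Set.disjoint_left.2 fun x hx hx' =>
      nonZeroDivisors.ne_zero hx' hx) ∅ {g} (by simp) (by simp [hg0])
  refine ⟨fun i => a (e i), ?_⟩
  have := ha g (by simp)
  rw [hg, eval_subst] at this
  simpa using this

theorem IsUniversalDomain.exists_fin_point (hU : IsUniversalDomain m U) {F : Type u} [Field F]
    [DeltaRing m F] (hF : #F < #U) {φ : F →+* U} (hφ : IsDeltaHom m φ) {k : ℕ}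
    {I : Ideal (DeltaPoly m (Fin k) F)} (hI : IsDeltaIdeal m I)
    {M : Submonoid (DeltaPoly m (Fin k) F)} (hM : Disjoint (I : Set (DeltaPoly m (Fin k) F)) M) :
    ∃ a : Fin k → U, (∀ f ∈ I, evalVia φ a f = 0) ∧ ∀ g ∈ M, evalVia φ a g ≠ 0 := by
  have := hU.charZero
  have hcoeff : ∀ f : DeltaPoly m (Fin k) F,
      HasCoeffsIn φ.fieldRange (MvPolynomial.map φ f : DeltaPoly m (Fin k) U) := fun f e => by
    rw [MvPolynomial.coeff_map]
    exact ⟨_, rfl⟩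
  -- Disjointness survives the extension of scalars to `U`, so differential closedness solves every
  -- finite subsystem; saturation then solves the whole system.
  have hdisj : Disjoint 
      ((I.map (MvPolynomial.map φ) : Ideal (DeltaPoly m (Fin k) U)) : Set (DeltaPoly m (Fin k) U))
      (M.map (MvPolynomial.map φ) : Submonoid (DeltaPoly m (Fin k) U)) := by
    rw [Set.disjoint_left]
    rintro _ h ⟨g, hg, rfl⟩
    refine Set.disjoint_left.1 hM ?_ hg
    have := MvPolynomial.comap_map_field φ I
    rw [← this]
    exact h
  obtain ⟨a, ha, ha'⟩ := hU.saturated φ.fieldRange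
    (by
      rintro i _ ⟨x, rfl⟩
      exact ⟨_, (hφ i x).symm⟩)
    ((Cardinal.mk_range_le (f := φ)).trans_lt hF) k
    (MvPolynomial.map φ '' I) (MvPolynomial.map φ '' M)
    (by rintro _ ⟨f, -, rfl⟩; exact hcoeff f) (by rintro _ ⟨f, -, rfl⟩; exact hcoeff f)
    (fun E N hE hN => hU.differentiallyClosed.exists_fin_solution
      (hI.map (isDeltaHom_map (σ := Fin k) hφ)) hdisj E N
      (fun f hf => by
        obtain ⟨g, hg, rfl⟩ := hE hf
        exact Ideal.mem_map_of_mem _ hg)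
      (fun f hf => by
        obtain ⟨g, hg, rfl⟩ := hN hf
        exact ⟨g, hg, rfl⟩))
  refine ⟨a, fun f hf => ?_, fun g hg => ?_⟩
  · rw [← eval_map]
    exact ha _ ⟨f, hf, rfl⟩
  · rw [← eval_map]
    exact ha' _ ⟨g, hg, rfl⟩

/-- A `Δ`-ideal over a small `Δ`-field inside a universal domain has a zero at which a given
disjoint submonoid of `Δ`-polynomials does not vanish. -/
theorem IsUniversalDomain.exists_point (hU : IsUniversalDomain m U) {F : Type u} [Field F]
    [DeltaRing m F] (hF : #F < #U) {φ : F →+* U} (hφ : IsDeltaHom m φ) {σ : Type*} [Finite σ]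
    {I : Ideal (DeltaPoly m σ F)} (hI : IsDeltaIdeal m I)
    {M : Submonoid (DeltaPoly m σ F)} (hM : Disjoint (I : Set (DeltaPoly m σ F)) M) :
    ∃ a : σ → U, (∀ f ∈ I, evalVia φ a f = 0) ∧ ∀ g ∈ M, evalVia φ a g ≠ 0 := by
  obtain ⟨k, ⟨e⟩⟩ := Finite.exists_equiv_fin σ
  let ρ : DeltaPoly m (Fin k) F →+* DeltaPoly m σ F :=
    evalVia MvPolynomial.C fun i => var (e.symm i)
  let ρ' : DeltaPoly m σ F →+* DeltaPoly m (Fin k) F :=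
    evalVia MvPolynomial.C fun i => var (e i)
  have hρ : ∀ f, ρ (ρ' f) = f := fun f => subst_var_equiv e.symm f
  have hρd : IsDeltaHom m ρ := evalVia_isDeltaHom isDeltaHom_C _
  obtain ⟨a, ha, ha'⟩ := hU.exists_fin_point hF hφ (I := I.comap ρ) (M := M.comap ρ)
    (fun i x hx => by
      rw [Ideal.mem_comap] at hx ⊢
      rw [← hρd]
      exact hI i _ hx)
    (Set.disjoint_left.2 fun x hx hx' => Set.disjoint_left.1 hM hx hx')
  have key : ∀ f, evalVia φ a (ρ' f) = evalVia φ (fun i => a (e i)) f := fun f => by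
    rw [evalVia_subst hφ]
    simp
  refine ⟨fun i => a (e i), fun f hf => ?_, fun g hg => ?_⟩
  · rw [← key]
    exact ha _ (by rwa [Ideal.mem_comap, hρ])
  · rw [← key]
    exact ha' _ (by rwa [Submonoid.mem_comap, hρ])

end Realization

/-! ### Separating an element from its copy in a tensor square. -/

section Tensor

open scoped TensorProduct

variable {k F : Type*} [Field k] [CharZero k] [Field F] [Algebra k F]

/-- An element outside the base field of characteristic zero has a different specialization. -/
theorem exists_ne_forall_aeval_eq_zero {α : F} (hα : α ∉ (algebraMap k F).range) :
    ∃ β : AlgebraicClosure F, β ≠ algebraMap F _ α ∧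
      ∀ p : Polynomial k, Polynomial.aeval α p = 0 → Polynomial.aeval β p = 0 := by
  by_cases h : IsIntegral k α
  · have hsep := (minpoly.irreducible h).separable
    have hcard := Polynomial.card_rootSet_eq_natDegree (K := AlgebraicClosure F) hsep
      (IsAlgClosed.splits _)
    have hdeg : 1 < (minpoly k α).natDegree := by
      by_contra! h'
      exact hα ((minpoly.natDegree_eq_one_iff).1 (le_antisymm h' (minpoly.natDegree_pos h)))
    rw [← hcard, Fintype.one_lt_card_iff_nontrivial] at hdeg
    obtain ⟨⟨β, hβ⟩, hne⟩ := exists_ne (⟨algebraMap F _ α, by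
      rw [Polynomial.mem_rootSet, Polynomial.aeval_algebraMap_apply, minpoly.aeval, map_zero]
      exact ⟨minpoly.ne_zero h, rfl⟩⟩ : (minpoly k α).rootSet (AlgebraicClosure F))
    refine ⟨β, fun h => hne (Subtype.ext h), fun p hp => ?_⟩
    obtain ⟨q, rfl⟩ := minpoly.dvd k α hp
    rw [map_mul, (Polynomial.mem_rootSet.1 hβ).2, zero_mul]
  -- For transcendental `α` only `p = 0` vanishes at `α`, so any other value would do.
  · refine ⟨algebraMap F _ α + 1, by simp, fun p hp => ?_⟩
    have : p = 0 := by
      by_contra hp0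
      exact h (IsAlgebraic.isIntegral ⟨p, hp0, hp⟩)
    simp [this]

/-- Specializing `α` to `β ≠ α` in the second factor maps `F ⊗ k[α]` to a field and the difference
to `β - α ≠ 0`. Flatness embeds `F ⊗ k[α]` into `F ⊗ F`. -/
theorem one_tmul_sub_tmul_one_pow_ne_zero {α : F} (hα : α ∉ (algebraMap k F).range) (N : ℕ) :
    ((1 : F) ⊗ₜ[k] α - α ⊗ₜ[k] (1 : F)) ^ N ≠ 0 := by
  obtain ⟨β, hne, hβ⟩ := exists_ne_forall_aeval_eq_zero hα
  let ψ : (Polynomial.aeval (R := k) α).range →ₐ[k] AlgebraicClosure F :=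
    (Ideal.Quotient.liftₐ (RingHom.ker (Polynomial.aeval (R := k) α).toRingHom)
      (Polynomial.aeval (R := k) β) (fun p hp => hβ p hp)).comp
      (Ideal.quotientKerEquivRange (Polynomial.aeval (R := k) α)).symm.toAlgHom
  let a : (Polynomial.aeval (R := k) α).range := ⟨α, Polynomial.X, by simp⟩
  have hψ : ψ a = β := by
    have : a = (Ideal.quotientKerEquivRange (Polynomial.aeval (R := k) α))
        (Ideal.Quotient.mk _ Polynomial.X) := by
      ext
      simp [a, Ideal.quotientKerEquivRange]
    have hψ' : ∀ x, ψ x = Ideal.Quotient.liftₐ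
      (RingHom.ker (Polynomial.aeval (R := k) α).toRingHom) (Polynomial.aeval (R := k) β)
      (fun p hp => hβ p hp)
      ((Ideal.quotientKerEquivRange (Polynomial.aeval (R := k) α)).symm x) := fun _ => rfl
    rw [hψ', this, AlgEquiv.symm_apply_apply]
    exact Polynomial.aeval_X β
  let ι : F →ₐ[k] AlgebraicClosure F := IsScalarTower.toAlgHom k F _
  have h1 : ((1 : F) ⊗ₜ[k] a - α ⊗ₜ[k] (1 : (Polynomial.aeval (R := k) α).range)) ^ N ≠ 0 := by
    intro h
    have := congrArg (Algebra.TensorProduct.lift ι ψ fun _ _ => Commute.all _ _) h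
    rw [map_pow, map_sub, map_zero] at this
    simp only [Algebra.TensorProduct.lift_tmul, map_one, one_mul, mul_one, hψ] at this
    exact hne (sub_eq_zero.1 (eq_zero_of_pow_eq_zero this))
  intro h
  apply h1
  have hinj : Function.Injective (Algebra.TensorProduct.map (AlgHom.id k F)
      (Polynomial.aeval (R := k) α).range.val) :=
    Module.Flat.lTensor_preserves_injective_linearMap _ Subtype.val_injective
  apply hinj
  simpa [a] using h

end Tensor

/-! ### Conjugate tuples over a small differential field. -/

section Conjugate

variable {m : ℕ} {U : Type u} [Field U] [DeltaRing m U]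

/-- The `Δ`-structure of a `Δ`-subfield. -/
@[reducible] def IsDeltaSubfield.deltaRing {K : Subfield U} (hK : IsDeltaSubfield m K) :
    DeltaRing m K where
  der i := Derivation.mk'
    (AddMonoidHom.toIntLinearMap
      { toFun := fun x => ⟨(der i : Derivation ℤ U U) x, hK i x x.2⟩
        map_zero' := by ext; simp
        map_add' := fun x y => by ext; simp })
    (fun x y => by ext; simp)
  der_comm i j x := by
    ext
    exact der_comm i j (x : U)

theorem IsDeltaSubfield.isDeltaHom_subtype {K : Subfield U} (hK : IsDeltaSubfield m K) :
    letI := hK.deltaRing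
    IsDeltaHom m K.subtype := fun _ _ => rfl

/-- Two tuples are conjugate over `K` if they satisfy the same `Δ`-polynomial equations over
`K`. -/
def DeltaConj (m : ℕ) [DeltaRing m U] (K : Subfield U) {σ : Type*} (a b : σ → U) : Prop :=
  ∀ f : DeltaPoly m σ K, evalVia K.subtype a f = 0 ↔ evalVia K.subtype b f = 0

theorem DeltaConj.symm {K : Subfield U} {σ : Type*} {a b : σ → U} (h : DeltaConj m K a b) :
    DeltaConj m K b a := fun f => (h f).symm

theorem DeltaConj.comp {K : Subfield U} (hK : IsDeltaSubfield m K) {σ τ : Type*} {a b : σ → U}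
    (h : DeltaConj m K a b) (e : τ → σ) :
    DeltaConj m K (fun i => a (e i)) (fun i => b (e i)) := by
  let _ := hK.deltaRing
  intro f
  have := h (evalVia MvPolynomial.C (fun i => var (e i)) f)
  rw [evalVia_subst hK.isDeltaHom_subtype, evalVia_subst hK.isDeltaHom_subtype] at this
  simpa using this

/-- The `Δ`-field generated by a finite tuple over a small `Δ`-subfield is small, and embeds
into `U` through each conjugate tuple. -/
theorem IsDeltaSubfield.exists_generatedField {K : Subfield U} (hK : IsDeltaSubfield m K)
    [CharZero U] (hKU : #K < #U) {σ : Type} [Finite σ] (a : σ → U) :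
    letI := hK.deltaRing
    ∃ (F : Type u) (_ : Field F) (_ : DeltaRing m F) (j : DeltaPoly m σ K →+* F),
      IsDeltaHom m j ∧ RingHom.ker j = RingHom.ker (evalVia (m := m) K.subtype a) ∧ #F < #U ∧
      ∀ b : σ → U, DeltaConj m K a b →
        ∃ φ : F →+* U, IsDeltaHom m φ ∧ φ.comp j = evalVia K.subtype b := by
  let _ := hK.deltaRing
  have := RingHom.ker_isPrime (evalVia (m := m) K.subtype a)
  obtain ⟨F, _, _, j, hj, hker, hcard, hlift⟩ := (evalVia_isDeltaHom hK.isDeltaHom_subtype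
    a).isDeltaIdeal_ker.exists_fractionField
  refine ⟨F, inferInstance, inferInstance, j, hj, hker, ?_, fun b hb => ?_⟩
  -- `K` is infinite, having characteristic zero, so adjoining countably many indeterminates does
  -- not raise the cardinality.
  · refine hcard.trans_lt (MvPolynomial.cardinalMk_le_max_lift.trans_lt ?_)
    have hK0 : Cardinal.aleph0 ≤ #K := Cardinal.aleph0_le_mk K
    have hc : #(σ × (Fin m → ℕ)) ≤ Cardinal.aleph0 := Cardinal.mk_le_aleph0
    have hc' : Cardinal.lift.{u} #(σ × (Fin m → ℕ)) ≤ Cardinal.aleph0 :=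
      Cardinal.lift_le_aleph0.2 hc
    rw [Cardinal.lift_id'.{0, u}]
    exact (max_le (max_le le_rfl (hc'.trans hK0)) hK0).trans_lt hKU
  · refine hlift U _ (evalVia_isDeltaHom hK.isDeltaHom_subtype b) ?_
    ext f
    exact (hb f).symm

/-- Conjugate tuples extend: a type over one of them is realized over the other. -/
theorem IsUniversalDomain.exists_deltaConj_elim (hU : IsUniversalDomain m U) {K : Subfield U}
    (hK : IsDeltaSubfield m K) (hKU : #K < #U) {σ τ : Type} [Finite σ] [Finite τ] {p p' : σ → U}
    (h : DeltaConj m K p p') (v' : τ → U) :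
    ∃ v : τ → U, DeltaConj m K (Sum.elim p v) (Sum.elim p' v') := by
  let _ := hK.deltaRing
  have := hU.charZero
  obtain ⟨F, _, _, j, hj, -, hF, hlift⟩ := hK.exists_generatedField hKU p
  obtain ⟨φ, hφ, hφj⟩ := hlift p fun _ => Iff.rfl
  obtain ⟨φ', hφ', hφj'⟩ := hlift p' h
  have := RingHom.ker_isPrime (evalVia (m := m) φ' v')
  -- The prime ideal of `v'` over `F`, embedded through `p'`, is realized generically over `F`
  -- embedded through `p`; avoiding its complement excludes extra equations.
  obtain ⟨v, hv, hv'⟩ := hU.exists_point hF hφ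
    (evalVia_isDeltaHom hφ' v').isDeltaIdeal_ker
    (M := (RingHom.ker (evalVia (m := m) φ' v')).primeCompl)
    (Set.disjoint_left.2 fun x hx hx' => hx' hx)
  let θ : DeltaPoly m (σ ⊕ τ) K →+* DeltaPoly m τ F :=
    evalVia (MvPolynomial.C.comp (j.comp MvPolynomial.C))
      (Sum.elim (fun i => MvPolynomial.C (j (var i))) var)
  have key : ∀ (χ : F →+* U), IsDeltaHom m χ → ∀ (q : σ → U) (w : τ → U),
      χ.comp j = evalVia K.subtype q → ∀ f,
      evalVia χ w (θ f) = evalVia K.subtype (Sum.elim q w) f := by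
    intro χ hχ q w hq f
    have hq' : ∀ g, χ (j g) = evalVia K.subtype q g := fun g => DFunLike.congr_fun hq g
    rw [map_evalVia (evalVia_isDeltaHom hχ w)]
    congr 1
    congr 1
    · ext x
      simp [hq']
    · funext i
      rcases i with i | i <;> simp [hq']
  refine ⟨v, fun f => ?_⟩
  rw [← key φ hφ p v hφj, ← key φ' hφ' p' v' hφj']
  constructor
  · intro hf
    by_contra hf'
    exact hv' _ hf' hf
  · exact fun hf => hv _ hf

/-- An entry outside `K` of a tuple is moved by some conjugation over `K`. -/
theorem IsUniversalDomain.exists_deltaConj_ne (hU : IsUniversalDomain m U) {K : Subfield U}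
    (hK : IsDeltaSubfield m K) (hKU : #K < #U) {σ : Type} [Finite σ] (c : σ → U) {e : σ}
    (he : c e ∉ K) : ∃ c' : σ → U, DeltaConj m K c' c ∧ c' e ≠ c e := by
  let _ := hK.deltaRing
  have := hU.charZero
  obtain ⟨F, _, _, j, hj, hker, hF, hlift⟩ := hK.exists_generatedField hKU c
  obtain ⟨φ, hφ, hφj⟩ := hlift c fun _ => Iff.rfl
  have hφj' : ∀ g, φ (j g) = evalVia K.subtype c g := fun g => DFunLike.congr_fun hφj g
  let jC : K →+* F := j.comp MvPolynomial.C
  have hjC : IsDeltaHom m jC := hj.comp isDeltaHom_C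
  let _ : Algebra K F := jC.toAlgebra
  have hα : j (var e) ∉ (algebraMap K F).range := by
    rintro ⟨x, hx⟩
    apply he
    have := hφj' (var e)
    rw [← hx] at this
    change φ (j (MvPolynomial.C x)) = _ at this
    rw [hφj', evalVia_C, evalVia_var] at this
    rw [← this]
    exact x.2
  have := RingHom.ker_isPrime (evalVia (m := m) K.subtype c)
  set P := RingHom.ker (evalVia (m := m) K.subtype c) with hP
  have hPd : IsDeltaIdeal m P := (evalVia_isDeltaHom hK.isDeltaHom_subtype c).isDeltaIdeal_ker
  -- The map `χ` need not respect derivations: it serves only to prove an ideal disjoint from a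
  -- submonoid.
  let χ : DeltaPoly m σ F →+* TensorProduct K F F :=
    MvPolynomial.eval₂Hom Algebra.TensorProduct.includeLeftRingHom
      fun p => Algebra.TensorProduct.includeRight (j (MvPolynomial.X p))
  have hχ : ∀ f : DeltaPoly m σ K, χ (MvPolynomial.map jC f) =
      Algebra.TensorProduct.includeRight (j f) := by
    intro f
    have : χ.comp (MvPolynomial.map jC) =
        (Algebra.TensorProduct.includeRight (R := K) (A := F) (B := F)).toRingHom.comp j := by
      apply MvPolynomial.ringHom_ext
      · intro x
        have h1 : jC x = algebraMap K F x := rfl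
        have h2 : j (MvPolynomial.C x) = algebraMap K F x := rfl
        simp [χ, h1, h2]
      · simp [χ]
    exact DFunLike.congr_fun this f
  set z : DeltaPoly m σ F := var e - MvPolynomial.C (j (var e)) with hz
  have hχz : χ z = (1 : F) ⊗ₜ[K] (j (var e)) - (j (var e)) ⊗ₜ[K] (1 : F) := by
    simp [χ, hz, var]
  -- Avoiding the image of the complement of `P` makes `c'` conjugate to `c`; avoiding the powers of
  -- `z` makes the entry at `e` different.
  obtain ⟨c', hc, hc'⟩ := hU.exists_point hF hφ (hPd.map (isDeltaHom_map (σ := σ) hjC))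
    (M := P.primeCompl.map (MvPolynomial.map jC) ⊔ Submonoid.powers z)
    (by
      rw [Set.disjoint_left]
      intro x hx hx'
      obtain ⟨_, ⟨g, hg, rfl⟩, _, ⟨N, rfl⟩, rfl⟩ := Submonoid.mem_sup.1 hx'
      have hx0 : χ (MvPolynomial.map jC g * z ^ N) = 0 := by
        have : P.map (MvPolynomial.map jC) ≤ RingHom.ker χ := by
          rw [Ideal.map_le_iff_le_comap]
          intro f hf
          rw [Ideal.mem_comap, RingHom.mem_ker, hχ]
          rw [← hker, RingHom.mem_ker] at hf
          rw [hf, map_zero]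
        exact this hx
      rw [map_mul, map_pow, hχ, hχz] at hx0
      have hunit : IsUnit (j g) := by
        rw [isUnit_iff_ne_zero, Ne, ← RingHom.mem_ker, hker]
        exact hg
      exact one_tmul_sub_tmul_one_pow_ne_zero hα N
        ((hunit.map (Algebra.TensorProduct.includeRight (R := K) (A := F))).mul_right_eq_zero.1 hx0))
  have key : ∀ f : DeltaPoly m σ K, evalVia φ c' (MvPolynomial.map jC f) =
      evalVia K.subtype c' f := by
    intro f
    rw [evalVia_map]
    congr 2
    ext x
    simp [jC, hφj']
  refine ⟨c', fun f => ⟨fun hf => ?_, fun hf => ?_⟩, fun h => ?_⟩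
  · by_contra hf'
    apply hc' (MvPolynomial.map jC f) (Submonoid.mem_sup_left ⟨f, hf', rfl⟩)
    rw [key, hf]
  · rw [← key]
    exact hc _ (Ideal.mem_map_of_mem _ hf)
  · apply hc' z (Submonoid.mem_sup_right (Submonoid.mem_powers z))
    simp [hz, h, hφj']

end Conjugate

/-- A subspace of polynomials is spanned by its elements with coefficients in the subfield `K` if
coefficients outside `K` of its normalized elements can be varied. -/
theorem MvPolynomial.mem_span_coeff_mem {τ U : Type*} [Field U] (K : Subfield U)
    (J : Submodule U (MvPolynomial τ U))
    (hJ : ∀ f ∈ J, ∀ e₀ e, f.coeff e₀ = 1 → f.coeff e ∉ K →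
      ∃ f' ∈ J, f'.support ⊆ f.support ∧ f'.coeff e₀ = 1 ∧ f'.coeff e ≠ f.coeff e)
    (f : MvPolynomial τ U) (hf : f ∈ J) :
    f ∈ Submodule.span U {g : MvPolynomial τ U | g ∈ J ∧ ∀ e, g.coeff e ∈ K} := by
  induction h : f.support.card using Nat.strong_induction_on generalizing f with
  | _ N ih =>
    subst h
    by_cases hf0 : f = 0
    · rw [hf0]
      exact zero_mem _
    obtain ⟨e₀, he₀⟩ := MvPolynomial.ne_zero_iff.1 hf0
    set c := f.coeff e₀ with hc
    have hdrop : ∀ g ∈ J, g.support ⊆ f.support → ∀ e, f.coeff e ≠ 0 → g.coeff e = 0 →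
        g ∈ Submodule.span U {g : MvPolynomial τ U | g ∈ J ∧ ∀ e, g.coeff e ∈ K} := by
      intro g hg hgf e he hge
      refine ih _ (Finset.card_lt_card (Finset.ssubset_iff_subset_ne.2 ⟨hgf, fun h => ?_⟩)) g hg rfl
      have : e ∈ g.support := by
        rw [h]
        exact MvPolynomial.mem_support_iff.2 he
      exact MvPolynomial.mem_support_iff.1 this hge
    set f₁ := c⁻¹ • f with hf₁
    have hf₁J : f₁ ∈ J := J.smul_mem _ hf
    have hf₁c : ∀ e, f₁.coeff e = c⁻¹ * f.coeff e := fun e => by rw [hf₁, MvPolynomial.coeff_smul]; rfl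
    have hf₁s : f₁.support ⊆ f.support := fun e he => by
      rw [MvPolynomial.mem_support_iff] at he ⊢
      intro h
      rw [hf₁c, h, mul_zero] at he
      exact he rfl
    have hff₁ : f = c • f₁ := by rw [hf₁, smul_smul, mul_inv_cancel₀ he₀, one_smul]
    rw [hff₁]
    refine Submodule.smul_mem _ _ ?_
    by_cases hK : ∀ e, f₁.coeff e ∈ K
    · exact Submodule.subset_span ⟨hf₁J, hK⟩
    push Not at hK
    obtain ⟨e, he⟩ := hK
    have hf₁0 : f₁.coeff e₀ = 1 := by rw [hf₁c, ← hc, inv_mul_cancel₀ he₀]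
    obtain ⟨f', hf'J, hf's, hf'0, hf'e⟩ := hJ f₁ hf₁J e₀ e hf₁0 he
    have hfe : f.coeff e ≠ 0 := by
      intro h
      rw [hf₁c, h, mul_zero] at he
      exact he K.zero_mem
    have hsub : ∀ a b : MvPolynomial τ U, a.support ⊆ f.support → b.support ⊆ f.support →
        (a - b).support ⊆ f.support := by
      classical
      exact fun a b ha hb => (MvPolynomial.support_sub τ a b).trans (Finset.union_subset ha hb)
    set g := f₁ - f' with hg
    have hgJ : g ∈ J := J.sub_mem hf₁J hf'J
    have hgs : g.support ⊆ f.support := hsub _ _ hf₁s (hf's.trans hf₁s)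
    have hgspan := hdrop g hgJ hgs e₀ he₀ (by rw [hg, MvPolynomial.coeff_sub, hf₁0, hf'0, sub_self])
    have hge : g.coeff e ≠ 0 := by
      rw [hg, MvPolynomial.coeff_sub, sub_ne_zero]
      exact hf'e.symm
    -- The difference `g` has lost the exponent `e₀`, and this multiple makes `f₁ - t • g` lose `e`.
    -- Both have smaller support than `f`, so induction applies to each.
    set t := f₁.coeff e / g.coeff e with ht
    have hspan := hdrop (f₁ - t • g) (J.sub_mem hf₁J (J.smul_mem _ hgJ))
      (hsub _ _ hf₁s (MvPolynomial.support_smul.trans hgs)) e hfe (by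
        have : (t • g).coeff e = f₁.coeff e := by
          rw [MvPolynomial.coeff_smul, smul_eq_mul, ht, div_mul_cancel₀ _ hge]
        rw [MvPolynomial.coeff_sub, this, sub_self])
    have := Submodule.add_mem _ hspan (Submodule.smul_mem _ t hgspan)
    rwa [sub_add_cancel] at this

/-! ### Homogeneity as a linear condition. -/

section Homogeneous

variable {m : ℕ} {σ U : Type*} [Field U] [DeltaRing m U]

/-- The deviation of `f` from `Δ`-homogeneity of degree `d`. -/
noncomputable def DeltaPoly.homogeneityDefect {R : Type*} [CommRing R] [DeltaRing m R] (σ : Type*)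
    (d : ℕ) : DeltaPoly m σ R →+ DeltaPoly m (Option σ) R :=
  (evalVia MvPolynomial.C fun i => var none * var (some i) :
      DeltaPoly m σ R →+* DeltaPoly m (Option σ) R).toAddMonoidHom -
    (AddMonoidHom.mulLeft (var none ^ d)).comp
      (evalVia MvPolynomial.C fun i => var (some i) :
        DeltaPoly m σ R →+* DeltaPoly m (Option σ) R).toAddMonoidHom

theorem DeltaPoly.homogeneityDefect_apply {R : Type*} [CommRing R] [DeltaRing m R]
    (d : ℕ) (f : DeltaPoly m σ R) :
    homogeneityDefect σ d f =
      evalVia (S := DeltaPoly m (Option σ) R) MvPolynomial.C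
        (fun i => var none * var (some i)) f -
      var none ^ d * evalVia (S := DeltaPoly m (Option σ) R) MvPolynomial.C
        (fun i => var (some i)) f := rfl

theorem DeltaPoly.isHomogeneousIn_univ_iff {R : Type*} [CommRing R] [DeltaRing m R]
    {d : ℕ} {f : DeltaPoly m σ R} :
    f.IsHomogeneousIn Set.univ d ↔ homogeneityDefect σ d f = 0 := by
  rw [homogeneityDefect_apply, sub_eq_zero, IsHomogeneousIn]
  simp

theorem DeltaPoly.homogeneityDefect_C_mul {R : Type*} [CommRing R] [DeltaRing m R]
    (d : ℕ) (c : R) (f : DeltaPoly m σ R) :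
    homogeneityDefect σ d (MvPolynomial.C c * f) = MvPolynomial.C c * homogeneityDefect σ d f := by
  simp only [homogeneityDefect_apply, map_mul, evalVia_C]
  ring

theorem DeltaPoly.map_homogeneityDefect {R S : Type*} [CommRing R] [DeltaRing m R] [CommRing S]
    [DeltaRing m S] {φ : R →+* S} (hφ : IsDeltaHom m φ) (d : ℕ) (f : DeltaPoly m σ R) :
    MvPolynomial.map φ (homogeneityDefect σ d f) =
      homogeneityDefect σ d (MvPolynomial.map φ f) := by
  have hC : (MvPolynomial.map φ).comp (MvPolynomial.C : R →+* DeltaPoly m (Option σ) R) =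
      MvPolynomial.C.comp φ := by
    ext x
    simp
  simp only [homogeneityDefect_apply, map_sub, map_mul, map_pow, evalVia_map]
  rw [map_evalVia (isDeltaHom_map hφ), map_evalVia (isDeltaHom_map hφ), hC]
  simp [var]

theorem DeltaPoly.IsHomogeneousIn.eval_rep_mk {n : ℕ} {d : ℕ} {f : DeltaPoly m (Fin (n + 1)) U}
    (hf : f.IsHomogeneousIn Set.univ d) {v : Fin (n + 1) → U} (hv : v ≠ 0) :
    eval (Projectivization.mk U v hv).rep f = 0 ↔ eval v f = 0 := by
  obtain ⟨t, ht⟩ := Projectivization.exists_smul_eq_mk_rep U v hv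
  rw [← ht, Units.smul_def, hf.eval_smul_univ]
  simp

/-- The `Δ`-homogeneous `Δ`-polynomials of degree `d` that vanish on `T`. -/
noncomputable def vanishingSubmodule (m : ℕ) [DeltaRing m U] {n : ℕ}
    (T : Set (ℙ U (Fin (n + 1) → U))) (d : ℕ) : Submodule U (DeltaPoly m (Fin (n + 1)) U) where
  carrier := {f | f.IsHomogeneousIn Set.univ d ∧ ∀ p ∈ T, eval p.rep f = 0}
  zero_mem' := by
    simp [isHomogeneousIn_univ_iff]
  add_mem' {f g} hf hg := by
    rw [Set.mem_ofPred_eq, isHomogeneousIn_univ_iff] at *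
    refine ⟨by rw [map_add, hf.1, hg.1, add_zero], fun p hp => ?_⟩
    rw [map_add, hf.2 p hp, hg.2 p hp, add_zero]
  smul_mem' c f hf := by
    rw [Set.mem_ofPred_eq, isHomogeneousIn_univ_iff] at *
    rw [MvPolynomial.smul_eq_C_mul, homogeneityDefect_C_mul, hf.1, mul_zero]
    refine ⟨rfl, fun p hp => ?_⟩
    rw [map_mul, hf.2 p hp, mul_zero]

end Homogeneous

/-! ### Descent of invariant closed sets to `K`. -/

section Descent

variable {m : ℕ} {U : Type u} [Field U] [DeltaRing m U] {K : Subfield U}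

theorem DeltaConj.ne_zero {σ : Type*} {v v' : σ → U} (h : DeltaConj m K v v') (hv' : v' ≠ 0) :
    v ≠ 0 := by
  obtain ⟨i, hi⟩ := Function.ne_iff.1 hv'
  intro hv
  apply hi
  have := (h (var i)).1 (by simp [hv])
  simpa using this

omit [DeltaRing m U] in
theorem DeltaPoly.HasCoeffsIn.exists_map_eq {σ : Type*} {f : DeltaPoly m σ U}
    (hf : HasCoeffsIn K f) : ∃ g : DeltaPoly m σ K, MvPolynomial.map K.subtype g = f := by
  rw [← Set.mem_range, MvPolynomial.mem_range_map_iff_coeffs_subset]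
  intro c hc
  obtain ⟨e, -, rfl⟩ := MvPolynomial.mem_coeffs_iff.1 hc
  exact ⟨⟨_, hf e⟩, rfl⟩

theorem DeltaConj.eval_eq_zero_iff {σ : Type*} {v v' : σ → U} (h : DeltaConj m K v v')
    {f : DeltaPoly m σ U} (hf : HasCoeffsIn K f) : eval v f = 0 ↔ eval v' f = 0 := by
  obtain ⟨g, rfl⟩ := hf.exists_map_eq
  rw [eval_map, eval_map]
  exact h g

/-- The polynomial with the exponents in `s` and the coefficients `w`. -/
noncomputable def DeltaPoly.ofCoeffs {σ R : Type*} [CommRing R] {s : Finset (σ × (Fin m → ℕ) →₀ ℕ)}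
    (w : s → R) : DeltaPoly m σ R :=
  ∑ x, MvPolynomial.C (w x) * MvPolynomial.monomial x.1 1

theorem DeltaPoly.coeff_ofCoeffs {σ R : Type*} [CommRing R] {s : Finset (σ × (Fin m → ℕ) →₀ ℕ)}
    (w : s → R) (x : s) : (ofCoeffs w : DeltaPoly m σ R).coeff x = w x := by
  classical
  rw [ofCoeffs, MvPolynomial.coeff_sum, Finset.sum_eq_single x]
  · simp [MvPolynomial.coeff_C_mul]
  · intro y _ hy
    rw [MvPolynomial.coeff_C_mul, MvPolynomial.coeff_monomial,
      if_neg fun h => hy (Subtype.ext h), mul_zero]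
  · simp

theorem DeltaPoly.support_ofCoeffs {σ R : Type*} [CommRing R]
    {s : Finset (σ × (Fin m → ℕ) →₀ ℕ)} (w : s → R) :
    (ofCoeffs w : DeltaPoly m σ R).support ⊆ s := by
  classical
  intro y hy
  by_contra hys
  rw [MvPolynomial.mem_support_iff, ofCoeffs, MvPolynomial.coeff_sum] at hy
  refine hy (Finset.sum_eq_zero fun x _ => ?_)
  rw [MvPolynomial.coeff_C_mul, MvPolynomial.coeff_monomial,
    if_neg fun h => hys (by rw [← h]; exact x.2), mul_zero]

theorem DeltaPoly.ofCoeffs_coeff {σ R : Type*} [CommRing R] (f : DeltaPoly m σ R)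
    {s : Finset (σ × (Fin m → ℕ) →₀ ℕ)} (hs : f.support ⊆ s) {w : s → R}
    (hw : ∀ x, w x = f.coeff x.1) : ofCoeffs w = f := by
  refine MvPolynomial.ext _ _ fun y => ?_
  by_cases hy : y ∈ s
  · exact (coeff_ofCoeffs w ⟨y, hy⟩).trans (hw ⟨y, hy⟩)
  · rw [MvPolynomial.notMem_support_iff.1 fun h => hy (hs h), ← MvPolynomial.notMem_support_iff]
    exact fun h => hy (support_ofCoeffs w h)

/-- Each coefficient of the homogeneity defect is a linear form in `c` with coefficients in `K`, so
its vanishing passes to conjugates. -/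
theorem DeltaConj.isHomogeneousIn_ofCoeffs (hK : IsDeltaSubfield m K) {σ : Type*} {d : ℕ}
    {s : Finset (σ × (Fin m → ℕ) →₀ ℕ)} {c c' : s → U} (h : DeltaConj m K c c')
    (hc : (ofCoeffs c : DeltaPoly m σ U).IsHomogeneousIn Set.univ d) :
    (ofCoeffs c' : DeltaPoly m σ U).IsHomogeneousIn Set.univ d := by
  let _ := hK.deltaRing
  rw [isHomogeneousIn_univ_iff] at hc ⊢
  let Q : s → DeltaPoly m (Option σ) K := fun x =>
    homogeneityDefect σ d (MvPolynomial.monomial x.1 1)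
  have key : ∀ w : s → U, ∀ μ, (homogeneityDefect σ d (ofCoeffs w)).coeff μ =
      evalVia K.subtype w (∑ x, MvPolynomial.C ((Q x).coeff μ) * var x : DeltaPoly m s K) := by
    intro w μ
    rw [ofCoeffs, map_sum, MvPolynomial.coeff_sum, map_sum]
    refine Finset.sum_congr rfl fun x _ => ?_
    have : (MvPolynomial.monomial x.1 1 : DeltaPoly m σ U) =
        MvPolynomial.map K.subtype (MvPolynomial.monomial x.1 1) := by simp
    rw [homogeneityDefect_C_mul, MvPolynomial.coeff_C_mul, this,
      ← map_homogeneityDefect hK.isDeltaHom_subtype, MvPolynomial.coeff_map, map_mul, evalVia_C,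
      evalVia_var, mul_comm]
  ext μ
  rw [key, MvPolynomial.coeff_zero, ← h, ← key, hc, MvPolynomial.coeff_zero]

/-- Treating the coefficients as indeterminates turns the vanishing of a polynomial at a point into
one equation over `K` in coefficients and point jointly, which joint conjugation preserves. -/
theorem evalVia_coeff_pairing (hK : IsDeltaSubfield m K) {σ : Type*}
    {s : Finset (σ × (Fin m → ℕ) →₀ ℕ)} (w : s → U) (v : σ → U) :
    letI := hK.deltaRing
    evalVia K.subtype (Sum.elim w v) (∑ x, var (Sum.inl x) *
      evalVia MvPolynomial.C (fun i => var (Sum.inr i)) (MvPolynomial.monomial x.1 1) :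
        DeltaPoly m (s ⊕ σ) K) = eval v (ofCoeffs w) := by
  let _ := hK.deltaRing
  rw [map_sum, ofCoeffs, map_sum]
  refine Finset.sum_congr rfl fun x _ => ?_
  rw [map_mul, map_mul, evalVia_subst hK.isDeltaHom_subtype, evalVia_var, eval_C]
  congr 1
  simp only [evalVia_var, Sum.elim_inr]
  rw [← eval_map]
  simp

/-- A `Δ`-closed set that is invariant under conjugation over `K` is defined over `K`. -/
theorem IsDeltaClosed.isDeltaClosedOver (hU : IsUniversalDomain m U) (hK : IsDeltaSubfield m K)
    (hKU : #K < #U) {n : ℕ} {T : Set (ℙ U (Fin (n + 1) → U))} (hT : IsDeltaClosed m T)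
    (hinv : ∀ (v v' : Fin (n + 1) → U) (hv : v ≠ 0) (hv' : v' ≠ 0), DeltaConj m K v v' →
      Projectivization.mk U v' hv' ∈ T → Projectivization.mk U v hv ∈ T) :
    IsDeltaClosedOver m K T := by
  have hspan : ∀ d, ∀ f ∈ vanishingSubmodule m T d, f ∈ Submodule.span U
      {g : DeltaPoly m (Fin (n + 1)) U | g ∈ vanishingSubmodule m T d ∧ ∀ e, g.coeff e ∈ K} := by
    intro d
    refine MvPolynomial.mem_span_coeff_mem K _ fun f hf e₀ e h0 he => ?_
    let c : f.support → U := fun x => f.coeff x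
    have hcf : ofCoeffs c = f := ofCoeffs_coeff f subset_rfl fun _ => rfl
    have hes : e ∈ f.support := MvPolynomial.mem_support_iff.2 fun h => he (h ▸ K.zero_mem)
    have hes0 : e₀ ∈ f.support := MvPolynomial.mem_support_iff.2 (by rw [h0]; exact one_ne_zero)
    obtain ⟨c', hc', hne⟩ := hU.exists_deltaConj_ne hK hKU c (e := ⟨e, hes⟩) he
    refine ⟨ofCoeffs c', ⟨hc'.symm.isHomogeneousIn_ofCoeffs hK ?_, fun p hp => ?_⟩,
      support_ofCoeffs _, ?_, ?_⟩
    · rw [hcf]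
      exact hf.1
    · by_contra hne
      -- Were the conjugate polynomial nonzero at `p ∈ T`, moving its coefficients back to those of
      -- `f` would move `p` to a point of `T` where `f` does not vanish.
      obtain ⟨v, hv⟩ := hU.exists_deltaConj_elim hK hKU hc'.symm p.rep
      let _ := hK.deltaRing
      have h1 := hv (∑ x, var (Sum.inl x) *
        evalVia MvPolynomial.C (fun i => var (Sum.inr i)) (MvPolynomial.monomial x.1 1))
      rw [evalVia_coeff_pairing hK, evalVia_coeff_pairing hK, hcf] at h1
      have hconj : DeltaConj m K v p.rep := hv.comp hK Sum.inr
      have hv0 := hconj.ne_zero p.rep_nonzero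
      have hmem := hinv v p.rep hv0 p.rep_nonzero hconj (by rwa [Projectivization.mk_rep])
      exact hne (h1.1 ((hf.1.eval_rep_mk hv0).1 (hf.2 _ hmem)))
    · rw [coeff_ofCoeffs c' ⟨e₀, hes0⟩, ← sub_eq_zero]
      have := (hc' (var ⟨e₀, hes0⟩ - 1)).2 (by simp [c, h0])
      simpa using this
    · rw [coeff_ofCoeffs c' ⟨e, hes⟩]
      exact hne
  obtain ⟨S, hS, hTS⟩ := hT
  refine ⟨{g | HasCoeffsIn K g ∧ ∃ d, g ∈ vanishingSubmodule m T d},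
    fun f hf => ⟨hf.1, hf.2.imp fun d hd => hd.1⟩, ?_⟩
  ext p
  refine ⟨fun hp f ⟨_, d, hd⟩ => hd.2 p hp, fun hp => ?_⟩
  rw [hTS]
  intro f hf
  obtain ⟨-, d, hd⟩ := hS f hf
  have hfJ : f ∈ vanishingSubmodule m T d := ⟨hd, fun q hq => by
    rw [hTS] at hq
    exact hq f hf⟩
  refine Submodule.span_induction (p := fun g _ => eval p.rep g = 0) ?_ (map_zero _) ?_ ?_
    (hspan d f hfJ)
  · exact fun g hg => hp g ⟨hg.2, d, hg.1⟩
  · intro x y _ _ hx hy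
    rw [map_add, hx, hy, add_zero]
  · intro c x _ hx
    rw [MvPolynomial.smul_eq_C_mul, map_mul, hx, mul_zero]

end Descent

/-! ### Linear dependence and hyperplane loci in projective space. -/

section Projective

variable {m : ℕ} {U : Type u} [Field U] [DeltaRing m U] {K : Subfield U} {n : ℕ}

theorem IsDeltaClosedOver.mk_mem_of_deltaConj {V : Set (ℙ U (Fin (n + 1) → U))}
    (hV : IsDeltaClosedOver m K V) {v v' : Fin (n + 1) → U} (hv : v ≠ 0) (hv' : v' ≠ 0)
    (h : DeltaConj m K v v') (hmem : Projectivization.mk U v' hv' ∈ V) :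
    Projectivization.mk U v hv ∈ V := by
  obtain ⟨S, hS, rfl⟩ := hV
  intro f hf
  obtain ⟨hfK, d, hd⟩ := hS f hf
  rw [hd.eval_rep_mk hv, h.eval_eq_zero_iff hfK, ← hd.eval_rep_mk hv']
  exact hmem f hf

theorem isDeltaClosed_univ : IsDeltaClosed m (Set.univ : Set (ℙ U (Fin (n + 1) → U))) :=
  ⟨∅, by simp, by simp⟩

theorem isDeltaClosed_empty : IsDeltaClosed m (∅ : Set (ℙ U (Fin (n + 1) → U))) := by
  refine ⟨{1}, ?_, by simp⟩
  rintro f rfl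
  exact ⟨fun _ => trivial, 0, by simp [IsHomogeneousIn]⟩

/-- The dot product of the representative of a point with a vector vanishes independently of the
representative. -/
theorem sum_rep_mk_mul_eq_zero {v : Fin (n + 1) → U} (hv : v ≠ 0) (a : Fin (n + 1) → U) :
    ∑ j, (Projectivization.mk U v hv).rep j * a j = 0 ↔ ∑ j, v j * a j = 0 := by
  obtain ⟨t, ht⟩ := Projectivization.exists_smul_eq_mk_rep U v hv
  rw [← ht]
  simp only [Units.smul_def, Pi.smul_apply, smul_eq_mul, mul_assoc, ← Finset.mul_sum]
  simp

theorem mk_mem_ld {V : Set (ℙ U (Fin (n + 1) → U))} {a : Fin (n + 1) → U} (ha : a ≠ 0) :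
    Projectivization.mk U a ha ∈ ld V ↔ IsLinDepOver V a := by
  refine ⟨?_, fun h => ⟨a, ha, rfl, h⟩⟩
  rintro ⟨b, hb, hab, v, hv, hsum⟩
  refine ⟨v, hv, ?_⟩
  obtain ⟨t, rfl⟩ := (Projectivization.mk_eq_mk_iff' U a b ha hb).1 hab.symm
  simp only [Pi.smul_apply, smul_eq_mul, mul_left_comm _ t, ← Finset.mul_sum, hsum, mul_zero]

theorem isDeltaClosedProd_incidence :
    IsDeltaClosedProd m {p : (ℙ U (Fin (n + 1) → U)) × (ℙ U (Fin (n + 1) → U)) |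
      ∑ j, p.1.rep j * p.2.rep j = 0} := by
  refine ⟨{∑ j, var (Sum.inl j) * var (Sum.inr j)}, ?_, ?_⟩
  · rintro f rfl
    refine ⟨⟨1, ?_⟩, 1, ?_⟩
    · simp [IsHomogeneousIn, Finset.mul_sum, mul_assoc]
    · simp [IsHomogeneousIn, Finset.mul_sum, mul_left_comm]
  · ext p
    simp

/-- Completeness is applied with `Y = ℙⁿ` to the incidence relation. -/
theorem IsDeltaComplete.isDeltaClosed_ld {V : Set (ℙ U (Fin (n + 1) → U))}
    (hV : IsDeltaComplete m V) : IsDeltaClosed m (ld V) := by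
  obtain ⟨D, hD, h⟩ := hV.2 n Set.univ ⟨Set.univ, ∅, isDeltaClosed_univ, isDeltaClosed_empty, by simp⟩
    _ isDeltaClosedProd_incidence
  rw [Set.inter_univ] at h
  suffices ld V = D by rwa [this]
  rw [← h]
  ext x
  rw [← Projectivization.mk_rep x, mk_mem_ld, Projectivization.mk_rep]
  constructor
  · rintro ⟨v, hv, hsum⟩
    exact ⟨(v, x), ⟨hsum, hv, trivial⟩, rfl⟩
  · rintro ⟨⟨v, _⟩, ⟨hsum, hv, -⟩, rfl⟩
    exact ⟨v, hv, hsum⟩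

/-- Orthogonality is preserved by conjugation over `K`. -/
theorem DeltaConj.sum_mul_eq_zero_iff {σ : Type*} [Fintype σ] {a b a' b' : σ → U}
    (h : DeltaConj m K (Sum.elim a b) (Sum.elim a' b')) :
    ∑ j, a j * b j = 0 ↔ ∑ j, a' j * b' j = 0 := by
  have key : ∀ c d : σ → U, evalVia K.subtype (Sum.elim c d)
      (∑ j, var (Sum.inl j) * var (Sum.inr j) : DeltaPoly m (σ ⊕ σ) K) = ∑ j, c j * d j := by
    intro c d
    rw [map_sum]
    refine Finset.sum_congr rfl fun j _ => ?_
    rw [RingHom.map_mul, evalVia_var, evalVia_var, Sum.elim_inl, Sum.elim_inr]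
  rw [← key, ← key]
  exact h _

/-- Extending the conjugation to a witness in `V` keeps the witness in `V`, which is defined over
`K`, and preserves orthogonality. -/
theorem IsUniversalDomain.ld_deltaConj (hU : IsUniversalDomain m U) (hK : IsDeltaSubfield m K)
    (hKU : #K < #U) {V : Set (ℙ U (Fin (n + 1) → U))} (hV : IsDeltaClosedOver m K V)
    {p p' : Fin (n + 1) → U} (hp : p ≠ 0) (hp' : p' ≠ 0) (h : DeltaConj m K p p')
    (hmem : Projectivization.mk U p' hp' ∈ ld V) : Projectivization.mk U p hp ∈ ld V := by
  rw [mk_mem_ld] at hmem ⊢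
  obtain ⟨x, hx, hsum⟩ := hmem
  obtain ⟨v, hv⟩ := hU.exists_deltaConj_elim hK hKU h x.rep
  have hconj : DeltaConj m K v x.rep := hv.comp hK Sum.inr
  have hv0 := hconj.ne_zero x.rep_nonzero
  refine ⟨_, hV.mk_mem_of_deltaConj hv0 x.rep_nonzero hconj (by rwa [Projectivization.mk_rep]), ?_⟩
  rw [sum_rep_mk_mul_eq_zero]
  simp only [mul_comm] at hsum ⊢
  exact hv.sum_mul_eq_zero_iff.2 (by simpa only [mul_comm] using hsum)

/-- The points of `V` whose orthogonal hyperplane is contained in the zero set of `f`. -/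
def hyperplaneLocus (m : ℕ) [DeltaRing m U] (V : Set (ℙ U (Fin (n + 1) → U)))
    (f : DeltaPoly m (Fin (n + 1)) U) : Set (ℙ U (Fin (n + 1) → U)) :=
  {x | x ∈ V ∧ ∀ a : Fin (n + 1) → U, ∑ j, x.rep j * a j = 0 → eval a f = 0}

/-- The vectors orthogonal to `v ≠ 0` are the values at `v` of the alternating matrices. -/
theorem exists_alternating_mulVec {v : Fin (n + 1) → U} (hv : v ≠ 0) {a : Fin (n + 1) → U}
    (h : ∑ j, v j * a j = 0) :
    ∃ B : Fin (n + 1) × Fin (n + 1) → U, a = fun j => ∑ k, (B (j, k) - B (k, j)) * v k := by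
  obtain ⟨i, hi⟩ := Function.ne_iff.1 hv
  rw [Pi.zero_apply] at hi
  -- Only column `i` is nonzero, scaled by `1 / v i` so that it produces `a`. The transpose
  -- contributes only to entry `i`, where it gives `(∑ a k * v k) / v i = 0`.
  refine ⟨fun q => if q.2 = i then a q.1 / v i else 0, ?_⟩
  funext j
  simp only [sub_mul, Finset.sum_sub_distrib, ite_mul, zero_mul, Finset.sum_ite_eq',
    Finset.mem_univ, if_true, div_mul_cancel₀ _ hi]
  split_ifs
  · have : ∑ k, a k / v i * v k = 0 := by
      simp only [div_mul_eq_mul_div, ← Finset.sum_div]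
      simp only [mul_comm (a _), h, zero_div]
    rw [this, sub_zero]
  · simp

theorem sum_mul_alternating_mulVec (v : Fin (n + 1) → U) (B : Fin (n + 1) × Fin (n + 1) → U) :
    ∑ j, v j * ∑ k, (B (j, k) - B (k, j)) * v k = 0 := by
  simp only [Finset.mul_sum, sub_mul, mul_sub, Finset.sum_sub_distrib]
  rw [sub_eq_zero, Finset.sum_comm]
  refine Finset.sum_congr rfl fun j _ => Finset.sum_congr rfl fun k _ => ?_
  ring

theorem mk_mem_hyperplaneLocus {V : Set (ℙ U (Fin (n + 1) → U))}
    {f : DeltaPoly m (Fin (n + 1)) U} {v : Fin (n + 1) → U} (hv : v ≠ 0) :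
    Projectivization.mk U v hv ∈ hyperplaneLocus m V f ↔ Projectivization.mk U v hv ∈ V ∧
      ∀ a : Fin (n + 1) → U, ∑ j, v j * a j = 0 → eval a f = 0 := by
  simp only [hyperplaneLocus, Set.mem_ofPred_eq, sum_rep_mk_mul_eq_zero]

/-- Parametrizing the hyperplane by alternating matrices makes the quantifier independent of the
point: for each fixed `B`, substituting `(B - Bᵀ)x` into `f` gives one homogeneous equation in `x`.
-/
theorem isDeltaClosed_hyperplaneLocus {V : Set (ℙ U (Fin (n + 1) → U))} (hV : IsDeltaClosed m V)
    {f : DeltaPoly m (Fin (n + 1)) U} {d : ℕ} (hf : f.IsHomogeneousIn Set.univ d) :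
    IsDeltaClosed m (hyperplaneLocus m V f) := by
  obtain ⟨S, hS, rfl⟩ := hV
  let g : (Fin (n + 1) × Fin (n + 1) → U) → DeltaPoly m (Fin (n + 1)) U := fun B =>
    evalVia MvPolynomial.C (fun j => ∑ k, MvPolynomial.C (B (j, k) - B (k, j)) * var k) f
  have hg : ∀ B x, eval x (g B) = eval (fun j => ∑ k, (B (j, k) - B (k, j)) * x k) f := by
    intro B x
    rw [eval_subst]
    congr 2
    funext j
    rw [map_sum]
    refine Finset.sum_congr rfl fun k _ => ?_
    rw [map_mul, eval_C, eval_var]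
  refine ⟨S ∪ Set.range g, ?_, ?_⟩
  · rintro _ (hs | ⟨B, rfl⟩)
    · exact hS _ hs
    · refine ⟨fun _ => trivial, d, ?_⟩
      -- Homogeneity of `g B` comes from substituting linear forms into the identity for `f`; these
      -- forms involve no derivatives, so `t` factors out.
      have h := congrArg (evalVia (S := DeltaPoly m (Option (Fin (n + 1))) U) MvPolynomial.C
        fun o : Option (Fin (n + 1)) => o.elim (var none)
          fun j => ∑ k, MvPolynomial.C (B (j, k) - B (k, j)) * var (some k)) hf
      simp only [Set.mem_univ, if_true, map_mul, map_pow, evalVia_var, Option.elim_none] at h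
      rw [evalVia_subst isDeltaHom_C, evalVia_subst isDeltaHom_C] at h
      simp only [map_mul, evalVia_var, Option.elim_none, Option.elim_some] at h
      simp only [IsHomogeneousIn, Set.mem_univ, if_true, g]
      rw [evalVia_subst isDeltaHom_C, evalVia_subst isDeltaHom_C]
      simp only [map_sum, map_mul, evalVia_C, evalVia_var]
      rw [← h]
      congr 2
      funext j
      rw [Finset.mul_sum]
      exact Finset.sum_congr rfl fun k _ => by ring
  · ext x
    constructor
    · rintro ⟨hx, hx'⟩ _ (hs | ⟨B, rfl⟩)
      · exact hx _ hs
      · rw [hg]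
        exact hx' _ (sum_mul_alternating_mulVec _ _)
    · intro hx
      refine ⟨fun s hs => hx s (Or.inl hs), fun a ha => ?_⟩
      obtain ⟨B, rfl⟩ := exists_alternating_mulVec x.rep_nonzero ha
      rw [← hg]
      exact hx _ (Or.inr ⟨B, rfl⟩)

theorem IsUniversalDomain.isDeltaClosedOver_hyperplaneLocus (hU : IsUniversalDomain m U)
    (hK : IsDeltaSubfield m K) (hKU : #K < #U) {V : Set (ℙ U (Fin (n + 1) → U))}
    (hV : IsDeltaClosed m V) (hVK : IsDeltaClosedOver m K V) {f : DeltaPoly m (Fin (n + 1)) U}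
    (hfK : HasCoeffsIn K f) {d : ℕ} (hf : f.IsHomogeneousIn Set.univ d) :
    IsDeltaClosedOver m K (hyperplaneLocus m V f) := by
  refine (isDeltaClosed_hyperplaneLocus hV hf).isDeltaClosedOver hU hK hKU ?_
  intro v v' hv hv' h hmem
  rw [mk_mem_hyperplaneLocus] at hmem ⊢
  refine ⟨hVK.mk_mem_of_deltaConj hv hv' h hmem.1, fun a ha => ?_⟩
  -- A vector orthogonal to `v` is carried to one orthogonal to `v'`, and vanishing of `f` is
  -- unchanged because `f` has coefficients in `K`.
  obtain ⟨a', ha'⟩ := hU.exists_deltaConj_elim hK hKU h.symm a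
  have hconj : DeltaConj m K a' a := ha'.comp hK Sum.inr
  rw [← hconj.eval_eq_zero_iff hfK]
  exact hmem.2 a' (ha'.sum_mul_eq_zero_iff.2 ha)

/-- A hyperplane on which a product of two `Δ`-polynomials vanishes lies in the zero set of one of
them. -/
theorem IsUniversalDomain.forall_eval_eq_zero_or (hU : IsUniversalDomain m U)
    {v : Fin (n + 1) → U} (hv : v ≠ 0) {f g : DeltaPoly m (Fin (n + 1)) U}
    (h : ∀ a : Fin (n + 1) → U, ∑ j, v j * a j = 0 → eval a f * eval a g = 0) :
    (∀ a : Fin (n + 1) → U, ∑ j, v j * a j = 0 → eval a f = 0) ∨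
      ∀ a : Fin (n + 1) → U, ∑ j, v j * a j = 0 → eval a g = 0 := by
  have := hU.charZero
  let ρ : DeltaPoly m (Fin (n + 1)) U →+* DeltaPoly m (Fin (n + 1) × Fin (n + 1)) U :=
    evalVia MvPolynomial.C
      (fun j => ∑ k, (var (j, k) - var (k, j)) * MvPolynomial.C (v k))
  have hρ : ∀ B f, eval B (ρ f) = eval (fun j => ∑ k, (B (j, k) - B (k, j)) * v k) f := by
    intro B f
    rw [eval_subst]
    simp
  have hne : ∀ f a, ∑ j, v j * a j = 0 → eval a f ≠ 0 → ρ f ≠ 0 := by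
    intro f a ha hfa h0
    obtain ⟨B, rfl⟩ := exists_alternating_mulVec hv ha
    rw [← hρ, h0, map_zero] at hfa
    exact hfa rfl
  by_contra! hcon
  obtain ⟨⟨a, ha, hfa⟩, b, hb, hgb⟩ := hcon
  -- The pullbacks to matrix space are nonzero in an integral domain, so their product is nonzero
  -- and fails to vanish at some matrix.
  obtain ⟨B, hB⟩ := hU.differentiallyClosed.exists_eval_ne_zero
    (mul_ne_zero (hne f a ha hfa) (hne g b hb hgb))
  rw [map_mul, hρ, hρ] at hB
  exact hB (h _ (sum_mul_alternating_mulVec v B))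

omit [DeltaRing m U] in
theorem exists_ne_zero_sum_mul_eq_zero (hn : 1 ≤ n) (v : Fin (n + 1) → U) :
    ∃ a : Fin (n + 1) → U, a ≠ 0 ∧ ∑ j, v j * a j = 0 := by
  have h : LinearMap.ker (Fintype.linearCombination U v) ≠ ⊥ := by
    apply LinearMap.ker_ne_bot_of_finrank_lt
    simp
    omega
  obtain ⟨a, ha, ha0⟩ := Submodule.exists_mem_ne_zero_of_ne_bot h
  refine ⟨a, ha0, ?_⟩
  rw [LinearMap.mem_ker, Fintype.linearCombination_apply] at ha
  simpa [mul_comm] using ha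

theorem DeltaPoly.IsHomogeneousIn.eval_zero_eq_zero {d : ℕ} {f : DeltaPoly m (Fin (n + 1)) U}
    (hf : f.IsHomogeneousIn Set.univ d) {a : Fin (n + 1) → U} (ha : eval a f = 0) :
    eval 0 f = 0 := by
  have := hf.eval_smul_univ 0 a
  rwa [zero_smul, ha, mul_zero] at this

theorem IsUniversalDomain.isIrreducibleOver_ld (hU : IsUniversalDomain m U) (hn : 1 ≤ n)
    (hK : IsDeltaSubfield m K) (hKU : #K < #U) {V : Set (ℙ U (Fin (n + 1) → U))}
    (hV : IsDeltaClosed m V) (hVK : IsDeltaClosedOver m K V) (hVirr : IsIrreducibleOver m K V) :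
    IsIrreducibleOver m K (ld V) := by
  obtain ⟨⟨x₀, hx₀⟩, hirr⟩ := hVirr
  refine ⟨?_, ?_⟩
  · obtain ⟨a, ha, hsum⟩ := exists_ne_zero_sum_mul_eq_zero hn x₀.rep
    exact ⟨Projectivization.mk U a ha, (mk_mem_ld ha).2 ⟨x₀, hx₀, hsum⟩⟩
  rintro _ _ ⟨S₁, hS₁, rfl⟩ ⟨S₂, hS₂, rfl⟩ hcover
  by_contra! hcon
  obtain ⟨h₁, h₂⟩ := hcon
  have hwit : ∀ S : Set (DeltaPoly m (Fin (n + 1)) U),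
      ¬ ld V ⊆ {p | ∀ f ∈ S, eval p.rep f = 0} → ∃ f ∈ S, ¬ V ⊆ hyperplaneLocus m V f := by
    intro S hS
    obtain ⟨p, hp, hpS⟩ := Set.not_subset.1 hS
    rw [Set.mem_ofPred_eq] at hpS
    push Not at hpS
    obtain ⟨f, hf, hfp⟩ := hpS
    rw [← Projectivization.mk_rep p, mk_mem_ld] at hp
    obtain ⟨v, hv, hsum⟩ := hp
    exact ⟨f, hf, fun hsub => hfp ((hsub hv).2 _ hsum)⟩
  obtain ⟨f₁, hf₁, hV₁⟩ := hwit S₁ h₁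
  obtain ⟨f₂, hf₂, hV₂⟩ := hwit S₂ h₂
  obtain ⟨hK₁, d₁, hd₁⟩ := hS₁ f₁ hf₁
  obtain ⟨hK₂, d₂, hd₂⟩ := hS₂ f₂ hf₂
  have hsub : V ⊆ hyperplaneLocus m V f₁ ∪ hyperplaneLocus m V f₂ := by
    intro x hx
    have hnz : ∀ a : Fin (n + 1) → U, a ≠ 0 → ∑ j, x.rep j * a j = 0 →
        eval a f₁ = 0 ∨ eval a f₂ = 0 := by
      intro a ha hsum
      refine (hcover ((mk_mem_ld ha).2 ⟨x, hx, hsum⟩)).imp (fun h => ?_) fun h => ?_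
      · exact (hd₁.eval_rep_mk ha).1 (h f₁ hf₁)
      · exact (hd₂.eval_rep_mk ha).1 (h f₂ hf₂)
    refine (hU.forall_eval_eq_zero_or x.rep_nonzero (f := f₁) (g := f₂) fun a hsum => ?_).imp
      (fun h => ⟨hx, h⟩) fun h => ⟨hx, h⟩
    rw [mul_eq_zero]
    by_cases ha : a = 0
    · subst ha
      obtain ⟨b, hb, hbsum⟩ := exists_ne_zero_sum_mul_eq_zero hn x.rep
      exact (hnz b hb hbsum).imp hd₁.eval_zero_eq_zero hd₂.eval_zero_eq_zero
    · exact hnz a ha hsum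
  exact (hirr _ _ (hU.isDeltaClosedOver_hyperplaneLocus hK hKU hV hVK hK₁ hd₁)
    (hU.isDeltaClosedOver_hyperplaneLocus hK hKU hV hVK hK₂ hd₂) hsub).elim hV₁ hV₂

end Projective

theorem theorem4p3 {m n : ℕ} (hn : 1 ≤ n) {U : Type*} [Field U] [DeltaRing m U]
    (hU : IsUniversalDomain m U) (K : Subfield U) (hK : IsDeltaSubfield m K) (hKsmall : #K < #U)
    (V : Set (ℙ U (Fin (n + 1) → U))) (hVcomplete : IsDeltaComplete m V)
    (hVK : IsDeltaClosedOver m K V) (hVirr : IsIrreducibleOver m K V) :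
    IsDeltaClosedOver m K (ld V) ∧ IsIrreducibleOver m K (ld V) :=
  ⟨hVcomplete.isDeltaClosed_ld.isDeltaClosedOver hU hK hKsmall fun _ _ hv hv' h hmem =>
      hU.ld_deltaConj hK hKsmall hVK hv hv' h hmem,
    hU.isIrreducibleOver_ld hn hK hKsmall hVcomplete.1 hVK hVirr⟩
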